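/- Let $\mathbf{F}_q$ be a finite field, $k\ge 1$, and let $F:[0,\infty)^k\to\mathbf{R}$ be smooth, symmetric in its variables, and supported on the simplex $\{\mathbf t\in[0,1]^k: t_1+\dots+t_k\le 1\}$. Let $\eta\in(0,1/2)$, and let $\mathcal H=\{h_1,\dots,h_k\}\subseteq\mathbf{F}_q[t]$ be a set of $k$ distinct polynomials that is admissible: $\mathcal H+(p)\ne\mathbf{F}_q[t]$ for every prime (i.e. monic irreducible) $p$. For $w,n\in\mathbf{N}$ put $W=\prod_{p\text{ prime},\ \deg p<w}p$ and $r=\eta n$. Write $\mathbf{A}_n$ for the set of monic polynomials of degree $n$ in $\mathbf{F}_q[t]$ (so $|\mathbf{A}_n|=q^n$), $|f|=q^{\deg f}$ for a nonzero polynomial $f$, $\varphi(f)=|(\mathbf{F}_q[t]/(f))^\times|$, and $\mu$ for the Möbius function of $\mathbf{F}_q[t]$. For $\epsilon>0$ let $$\mathcal{P}_\epsilon(\mathcal H)=\Big\{f\in\mathbf{F}_q[t]: \text{the least degree of a prime factor of } \textstyle\prod_{j=1}^k(f+h_j)\text{ is}\ge\epsilon n\Big\},$$ and for monic $d_1,\dots,d_k$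 let $$\lambda_{d_1,\dots,d_k}=\Big(\prod_{j=1}^k\mu(d_j)\Big)F\Big(\frac{\deg d_1}{r},\dots,\frac{\deg d_k}{r}\Big).$$ Then there is a constant $C>0$, depending only on $q,k,F,\eta,\mathcal H$, such that for every $c>0$ there is a $w_0$ with the following property. For all $w\ge w_0$, all $n$ with $w\le c\log\log n$, all $b\in\mathbf{F}_q[t]$ with $(W,b+h_j)=1$ for $j=1,\dots,k$, and all $\epsilon\in(0,\eta)$, $$\sum_{\substack{f\in\mathbf{A}_n\setminus\mathcal{P}_\epsilon(\mathcal H)\\ f\equiv b\bmod W}}\Big(\sum_{\substack{d_1,\dots,d_k\\ d_j\mid f+h_j\ \forall j}}\lambda_{d_1,\dots,d_k}\Big)^2\ \le\ C\,\epsilon\,\frac{|W|^{k-1}}{\varphi(W)^k}\,\frac{|\mathbf{A}_n|}{r^k},$$ where the inner sum runs over monic $d_1,\dots,d_k$ such that $d_1,\dots,d_k,W$ are pairwise coprime. -/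

import Mathlib

open Polynomial
open scoped ContDiff Pointwise

noncomputable section

namespace PolySieve

/-- A prime of `𝔽_q[t]`: a monic irreducible polynomial. -/
def IsPrimePoly {K : Type*} [Field K] (p : K[X]) : Prop :=
  p.Monic ∧ Irreducible p

/-- A set `H` is admissible if `H + (p) ≠ 𝔽_q[t]` for every prime `p`. -/
def Admissible {K : Type*} [Field K] (H : Set K[X]) : Prop :=
  ∀ p : K[X], IsPrimePoly p → H + (Ideal.span {p} : Set K[X]) ≠ Set.univ

/-- `A_n`: the monic polynomials of degree `n`. -/
def monicOfDegree (K : Type*) [Field K] (n : ℕ) : Set K[X] :=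
  {f | f.Monic ∧ f.natDegree = n}

/-- `W`: the product of all primes of degree less than `w`. -/
def primorial (K : Type*) [Field K] (w : ℕ) : K[X] :=
  ∏ᶠ p ∈ {p : K[X] | IsPrimePoly p ∧ p.natDegree < w}, p

/-- The norm `|f| = q ^ deg f` (used for nonzero `f` only). -/
def polyNorm {K : Type*} [Field K] [Fintype K] (f : K[X]) : ℝ :=
  (Fintype.card K : ℝ) ^ f.natDegree

/-- Euler's totient `φ(f)`: the number of units of `𝔽_q[t] / (f)`. -/
def totient {K : Type*} [Field K] (f : K[X]) : ℕ :=
  Nat.card (K[X] ⧸ Ideal.span {f})ˣ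

open Classical in
/-- The Möbius function of `𝔽_q[t]`. -/
def moebius {K : Type*} [Field K] (f : K[X]) : ℝ :=
  if Squarefree f then (-1) ^ (UniqueFactorizationMonoid.factors f).card else 0

/-- `P⁻(f)`: the least degree of a prime factor of `f` (used for non-constant `f` only). -/
def leastPrimeDegree {K : Type*} [Field K] (f : K[X]) : ℕ :=
  sInf {m | ∃ p : K[X], IsPrimePoly p ∧ p ∣ f ∧ p.natDegree = m}

/-- `P_ε(H)` for `H = {h_1, …, h_k}`: those `f` with `P⁻(∏ j, (f + h_j)) ≥ ε n`. -/
def almostPrimeTranslates {K : Type*} [Field K] {k : ℕ} (h : Fin k → K[X]) (ε : ℝ) (n : ℕ) :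
    Set K[X] :=
  {f | ε * n ≤ leastPrimeDegree (∏ j, (f + h j))}

/-- The orthant `[0,∞)^k`. -/
def orthant (k : ℕ) : Set (Fin k → ℝ) :=
  {t | ∀ j, 0 ≤ t j}

/-- The simplex `{t ∈ [0,1]^k : t_1 + ⋯ + t_k ≤ 1}`. -/
def simplex (k : ℕ) : Set (Fin k → ℝ) :=
  {t | (∀ j, t j ∈ Set.Icc (0 : ℝ) 1) ∧ ∑ j, t j ≤ 1}

/-- `F : [0,∞)^k → ℝ` is smooth, symmetric and supported on the simplex.
The values of `F` outside the orthant play no role. -/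
structure IsSieveFunction {k : ℕ} (F : (Fin k → ℝ) → ℝ) : Prop where
  smooth : ContDiffOn ℝ ∞ F (orthant k)
  symmetric : ∀ (σ : Equiv.Perm (Fin k)), ∀ t ∈ orthant k, F (fun j => t (σ j)) = F t
  supported : ∀ t ∈ orthant k, t ∉ simplex k → F t = 0

/-- `λ_{d_1, …, d_k} = (∏ j, μ(d_j)) F(deg d_1 / r, …, deg d_k / r)`. -/
def sieveWeight {K : Type*} [Field K] {k : ℕ} (F : (Fin k → ℝ) → ℝ) (r : ℝ)
    (d : Fin k → K[X]) : ℝ :=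
  (∏ j, moebius (d j)) * F (fun j => ((d j).natDegree : ℝ) / r)

/-- The tuples over which the weights are summed for a given `f`: monic `d_1, …, d_k` with
`d_1, …, d_k, W` pairwise coprime and `d_j ∣ f + h_j` for all `j`. -/
def sieveTuples {K : Type*} [Field K] {k : ℕ} (h : Fin k → K[X]) (w : ℕ) (f : K[X]) :
    Set (Fin k → K[X]) :=
  {d | (∀ j, (d j).Monic) ∧ (∀ i j, i ≠ j → IsCoprime (d i) (d j)) ∧
    (∀ j, IsCoprime (d j) (primorial K w)) ∧ ∀ j, d j ∣ f + h j}

/-- The sum over `f ∈ A_n ∖ P_ε(H)`, `f ≡ b mod W`, of `(∑ λ_{d_1, …, d_k})²`. -/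
def exceptionalSum {K : Type*} [Field K] {k : ℕ} (F : (Fin k → ℝ) → ℝ) (h : Fin k → K[X])
    (r ε : ℝ) (w n : ℕ) (b : K[X]) : ℝ :=
  ∑ᶠ f ∈ {f : K[X] | f ∈ monicOfDegree K n \ almostPrimeTranslates h ε n ∧
      primorial K w ∣ f - b},
    (∑ᶠ d ∈ sieveTuples h w f, sieveWeight F r d) ^ 2

/-! The sums and products above are over finite sets, so none of them takes a default value. -/

theorem finite_natDegree_le (K : Type*) [Field K] [Fintype K] (n : ℕ) :
    {f : K[X] | f.natDegree ≤ n}.Finite := by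
  refine Set.Finite.of_finite_image (f := fun (f : K[X]) (i : Fin (n + 1)) => f.coeff i)
    (Set.toFinite _) ?_
  intro f hf g hg hfg
  ext i
  by_cases hi : i < n + 1
  · exact congrFun hfg ⟨i, hi⟩
  · rw [coeff_eq_zero_of_natDegree_lt (lt_of_le_of_lt hf (by omega)),
      coeff_eq_zero_of_natDegree_lt (lt_of_le_of_lt hg (by omega))]

theorem finite_primes (K : Type*) [Field K] [Fintype K] (w : ℕ) :
    {p : K[X] | IsPrimePoly p ∧ p.natDegree < w}.Finite :=
  (finite_natDegree_le K w).subset fun _ hp => hp.2.le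

theorem finite_monicOfDegree (K : Type*) [Field K] [Fintype K] (n : ℕ) :
    (monicOfDegree K n).Finite :=
  (finite_natDegree_le K n).subset fun _ hf => hf.2.le

theorem finite_sieveTuples {K : Type*} [Field K] [Fintype K] {k : ℕ} (h : Fin k → K[X])
    (w : ℕ) (f : K[X]) (hf : ∀ j, f + h j ≠ 0) : (sieveTuples h w f).Finite := by
  refine (Set.Finite.pi fun j => finite_natDegree_le K (f + h j).natDegree).subset ?_
  intro d hd j _
  exact natDegree_le_of_dvd (hd.2.2.2 j) (hf j)

end PolySieve

end

noncomputable section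

namespace PolySieve

section Abstract

set_option linter.unusedSectionVars false

variable {ι : Type*} [DecidableEq ι]

/-- The norm of a squarefree product, given by its finite set of prime factors. -/
def setNorm (N : ι → ℝ) (D : Finset ι) : ℝ := ∏ p ∈ D, N p

/-- The degree of a squarefree product, given by its finite set of prime factors. -/
def setDeg (deg : ι → ℕ) (D : Finset ι) : ℕ := ∑ p ∈ D, deg p

/-- The factor `|V| / φ(V)` of a squarefree product. -/
def eulerFactor (N : ι → ℝ) (V : Finset ι) : ℝ := ∏ p ∈ V, (1 - 1 / N p)⁻¹

/-- The normalised Mertens sum over squarefree products of degree at most `L` with all prime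
factors in `R`. -/
def mertensSum (N : ι → ℝ) (deg : ι → ℕ) (R : Finset ι) (L : ℕ) : ℝ :=
  ∑ D ∈ R.powerset, if setDeg deg D ≤ L then (-1) ^ D.card / setNorm N D else 0

/-- Abstract properties of the primes of degree at most `n`. -/
structure PrimeSystem (N : ι → ℝ) (deg : ι → ℕ) (P : Finset ι) (n : ℕ) : Prop where
  two_le : ∀ p ∈ P, 2 ≤ N p
  deg_pos : ∀ p ∈ P, 1 ≤ deg p
  mertens : ∀ L ≤ n, mertensSum N deg P L = if L = 0 then 1 else 0
  count : ∀ L : ℕ, ∑ D ∈ P.powerset, (if setDeg deg D ≤ L then 1 / setNorm N D else 0) ≤ L + 1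
  sum_sq : ∑ p ∈ P, 1 / N p ^ 2 ≤ 1

/-- A decreasing weight supported on `[0, l]` with slope at most `B`. -/
structure SlopeBound (β : ℕ → ℝ) (l : ℕ) (B : ℝ) : Prop where
  anti : ∀ x, β (x + 1) ≤ β x
  slope : ∀ x, β x - β (x + 1) ≤ B
  supp : ∀ x, l < x → β x = 0

variable {N : ι → ℝ} {deg : ι → ℕ} {P : Finset ι} {n : ℕ}

theorem setNorm_pos {D : Finset ι} (h : ∀ p ∈ D, 2 ≤ N p) : 0 < setNorm N D :=
  Finset.prod_pos fun p hp => by linarith [h p hp]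

theorem setNorm_insert {p : ι} {D : Finset ι} (hp : p ∉ D) :
    setNorm N (insert p D) = N p * setNorm N D := Finset.prod_insert hp

theorem setDeg_insert {p : ι} {D : Finset ι} (hp : p ∉ D) :
    setDeg deg (insert p D) = deg p + setDeg deg D := Finset.sum_insert hp

theorem setNorm_union {D E : Finset ι} (h : Disjoint D E) :
    setNorm N (D ∪ E) = setNorm N D * setNorm N E := Finset.prod_union h

theorem setDeg_union {D E : Finset ι} (h : Disjoint D E) :
    setDeg deg (D ∪ E) = setDeg deg D + setDeg deg E := Finset.sum_union h

theorem one_le_eulerFactor {V : Finset ι} (h : ∀ p ∈ V, 2 ≤ N p) : 1 ≤ eulerFactor N V := by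
  rw [← Finset.prod_const_one (s := V)]
  refine Finset.prod_le_prod (fun _ _ => zero_le_one) fun p hp => ?_
  have h2 := h p hp
  have : 1 / N p ≤ 1 / 2 := one_div_le_one_div_of_le (by norm_num) h2
  have h3 : 0 < 1 / N p := by positivity
  exact (one_le_inv₀ (by linarith)).2 (by linarith)

theorem eulerFactor_le_two_pow {V : Finset ι} (h : ∀ p ∈ V, 2 ≤ N p) :
    eulerFactor N V ≤ 2 ^ V.card := by
  rw [← Finset.prod_const]
  refine Finset.prod_le_prod (fun p hp => ?_) fun p hp => ?_
  all_goals
    have h2 := h p hp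
    have : 1 / N p ≤ 1 / 2 := one_div_le_one_div_of_le (by norm_num) h2
  · exact inv_nonneg.2 (by linarith)
  · rw [inv_le_comm₀ (by linarith) (by norm_num)]; linarith

theorem eulerFactor_union {D E : Finset ι} (h : Disjoint D E) :
    eulerFactor N (D ∪ E) = eulerFactor N D * eulerFactor N E := Finset.prod_union h

theorem sum_powerset_union {M : Type*} [AddCommMonoid M] {s t : Finset ι} (h : Disjoint s t)
    (f : Finset ι → M) :
    ∑ d ∈ (s ∪ t).powerset, f d = ∑ a ∈ s.powerset, ∑ b ∈ t.powerset, f (a ∪ b) := by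
  induction s using Finset.induction_on generalizing f with
  | empty => simp
  | insert p s hp ih =>
    have hpt : p ∉ t := Finset.disjoint_left.1 h (Finset.mem_insert_self p s)
    have hst : Disjoint s t := h.mono_left (Finset.subset_insert p s)
    rw [Finset.insert_union, Finset.sum_powerset_insert (by simp [hp, hpt]),
      Finset.sum_powerset_insert hp, ih hst, ih hst]
    simp only [Finset.insert_union]

theorem mertensSum_insert {R : Finset ι} {p : ι} (hp : p ∉ R) (L : ℕ) :
    mertensSum N deg (insert p R) L = mertensSum N deg R L -
      (if deg p ≤ L then mertensSum N deg R (L - deg p) else 0) / N p := by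
  unfold mertensSum
  rw [Finset.sum_powerset_insert hp, sub_eq_add_neg]
  congr 1
  split_ifs with hL
  · rw [← neg_div, ← Finset.sum_neg_distrib, Finset.sum_div]
    refine Finset.sum_congr rfl fun D hD => ?_
    have hpD : p ∉ D := fun h => hp (Finset.mem_powerset.1 hD h)
    rw [setDeg_insert hpD, Finset.card_insert_of_notMem hpD, setNorm_insert hpD]
    have : deg p + setDeg deg D ≤ L ↔ setDeg deg D ≤ L - deg p := by omega
    simp only [this]
    split_ifs
    · rw [mul_comm (N p), ← div_div]; congr 1; rw [pow_succ]; ring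
    · simp
  · rw [zero_div, neg_zero]
    refine Finset.sum_eq_zero fun D hD => ?_
    have hpD : p ∉ D := fun h => hp (Finset.mem_powerset.1 hD h)
    rw [setDeg_insert hpD, if_neg (by omega)]

/-- Excluding a set `V` of primes keeps the Mertens sums nonnegative and multiplies their total
by at most `|V| / φ(V)`. -/
theorem PrimeSystem.mertensSum_sdiff (hP : PrimeSystem N deg P n) {V : Finset ι} (hV : V ⊆ P) :
    (∀ L ≤ n, 0 ≤ mertensSum N deg (P \ V) L) ∧
      ∀ M ≤ n, ∑ L ∈ Finset.range (M + 1), mertensSum N deg (P \ V) L ≤ eulerFactor N V := by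
  induction V using Finset.induction_on with
  | empty =>
    refine ⟨fun L hL => ?_, fun M hM => ?_⟩
    · rw [Finset.sdiff_empty, hP.mertens L hL]; split_ifs <;> norm_num
    · rw [Finset.sdiff_empty, Finset.sum_congr rfl fun L hL => hP.mertens L
        (by rw [Finset.mem_range] at hL; omega)]
      simp [eulerFactor]
  | insert p V hpV ih =>
    have hpP : p ∈ P := hV (Finset.mem_insert_self p V)
    obtain ⟨ih1, ih2⟩ := ih ((Finset.subset_insert p V).trans hV)
    set R := P \ insert p V with hR
    have hpR : p ∉ R := by simp [hR]
    have hins : P \ V = insert p R := by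
      ext x; simp only [hR, Finset.mem_sdiff, Finset.mem_insert]
      by_cases hx : x = p
      · subst hx; simp [hpP, hpV]
      · simp [hx]
    rw [hins] at ih1 ih2
    have hN := hP.two_le p hpP
    have hN0 : 0 < N p := by linarith
    have hdeg := hP.deg_pos p hpP
    have key : ∀ L, mertensSum N deg R L = mertensSum N deg (insert p R) L +
        (if deg p ≤ L then mertensSum N deg R (L - deg p) else 0) / N p := by
      intro L; rw [mertensSum_insert hpR]; ring
    have hnn : ∀ L ≤ n, 0 ≤ mertensSum N deg R L := by
      intro L
      induction L using Nat.strong_induction_on with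
      | _ L ihL =>
        intro hL
        rw [key L]
        refine add_nonneg (ih1 L hL) (div_nonneg ?_ hN0.le)
        split_ifs with h
        · exact ihL _ (by omega) (by omega)
        · exact le_rfl
    refine ⟨hnn, fun M hM => ?_⟩
    have hshift : ∑ L ∈ Finset.range (M + 1),
        (if deg p ≤ L then mertensSum N deg R (L - deg p) else 0) ≤
        ∑ L ∈ Finset.range (M + 1), mertensSum N deg R L := by
      rw [← Finset.sum_filter]
      rw [← Finset.sum_image (s := (Finset.range (M + 1)).filter (deg p ≤ ·))
        (g := fun L => L - deg p) (f := fun L => mertensSum N deg R L)]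
      · refine Finset.sum_le_sum_of_subset_of_nonneg ?_ fun L hL _ => hnn L ?_
        · intro x hx
          simp only [Finset.mem_image, Finset.mem_filter, Finset.mem_range] at hx ⊢
          obtain ⟨y, hy, rfl⟩ := hx; omega
        · rw [Finset.mem_range] at hL; omega
      · intro x hx y hy hxy
        simp only [Finset.coe_filter, Set.mem_ofPred_eq] at hx hy
        simp only at hxy
        omega
    have hS : ∑ L ∈ Finset.range (M + 1), mertensSum N deg R L ≤
        ∑ L ∈ Finset.range (M + 1), mertensSum N deg (insert p R) L +
        (∑ L ∈ Finset.range (M + 1), mertensSum N deg R L) / N p := by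
      conv_lhs => rw [Finset.sum_congr rfl fun L _ => key L, Finset.sum_add_distrib,
        ← Finset.sum_div]
      gcongr
    have h2 := ih2 M hM
    have hE : eulerFactor N (insert p V) = (1 - 1 / N p)⁻¹ * eulerFactor N V :=
      Finset.prod_insert hpV
    have h1N : 0 < 1 - 1 / N p := by
      have : 1 / N p ≤ 1 / 2 := one_div_le_one_div_of_le (by norm_num) hN
      linarith
    rw [hE, inv_mul_eq_div, le_div_iff₀ h1N]
    calc _ = ∑ L ∈ Finset.range (M + 1), mertensSum N deg R L -
          (∑ L ∈ Finset.range (M + 1), mertensSum N deg R L) / N p := by ring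
      _ ≤ _ := by linarith

theorem SlopeBound.eq_sum {β : ℕ → ℝ} {l : ℕ} {B : ℝ} (hβ : SlopeBound β l B) {M : ℕ}
    (hM : l ≤ M) (x : ℕ) :
    β x = ∑ L ∈ Finset.range (M + 1), if x ≤ L then β L - β (L + 1) else 0 := by
  have h : ∀ m, ∑ L ∈ Finset.range m, (if x ≤ L then β L - β (L + 1) else 0) =
      if x ≤ m then β x - β m else 0 := by
    intro m
    induction m with
    | zero => simp; intro h; subst h; simp
    | succ m ih =>
      rw [Finset.sum_range_succ, ih]
      rcases lt_trichotomy x (m + 1) with h | h | h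
      · rw [if_pos (by omega), if_pos (by omega), if_pos (by omega)]; ring
      · subst h; simp
      · rw [if_neg (by omega), if_neg (by omega), if_neg (by omega)]; ring
  rw [h]
  split_ifs with hx
  · rw [hβ.supp (M + 1) (by omega)]; ring
  · exact hβ.supp x (by omega)

theorem SlopeBound.shift {β : ℕ → ℝ} {l : ℕ} {B : ℝ} (hβ : SlopeBound β l B) (c : ℕ) :
    SlopeBound (fun x => β (x + c)) l B where
  anti x := by have := hβ.anti (x + c); simpa [add_right_comm] using this
  slope x := by have := hβ.slope (x + c); simpa [add_right_comm] using this
  supp x hx := hβ.supp _ (by omega)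

/-- `∑ μ(D) β(deg D) / |D|` over squarefree products of primes in `R`. -/
def linearSum (N : ι → ℝ) (deg : ι → ℕ) (R : Finset ι) (β : ℕ → ℝ) : ℝ :=
  ∑ D ∈ R.powerset, (-1) ^ D.card / setNorm N D * β (setDeg deg D)

theorem PrimeSystem.linearSum_mem (hP : PrimeSystem N deg P n) {V : Finset ι} (hV : V ⊆ P)
    {β : ℕ → ℝ} {l : ℕ} {B : ℝ} (hβ : SlopeBound β l B) (hl : l ≤ n) (hB : 0 ≤ B) :
    0 ≤ linearSum N deg (P \ V) β ∧ linearSum N deg (P \ V) β ≤ B * eulerFactor N V := by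
  obtain ⟨h1, h2⟩ := hP.mertensSum_sdiff hV
  have h : linearSum N deg (P \ V) β = ∑ L ∈ Finset.range (n + 1),
      (β L - β (L + 1)) * mertensSum N deg (P \ V) L := by
    unfold linearSum mertensSum
    simp_rw [Finset.mul_sum]
    rw [Finset.sum_comm]
    refine Finset.sum_congr rfl fun D _ => ?_
    rw [hβ.eq_sum hl (setDeg deg D), Finset.mul_sum]
    refine Finset.sum_congr rfl fun L _ => ?_
    split_ifs <;> ring
  rw [h]
  have hL : ∀ L ∈ Finset.range (n + 1), 0 ≤ mertensSum N deg (P \ V) L := fun L hL =>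
    h1 L (by rw [Finset.mem_range] at hL; omega)
  refine ⟨Finset.sum_nonneg fun L hLr => mul_nonneg (sub_nonneg.2 (hβ.anti L)) (hL L hLr), ?_⟩
  calc _ ≤ ∑ L ∈ Finset.range (n + 1), B * mertensSum N deg (P \ V) L :=
        Finset.sum_le_sum fun L hLr => mul_le_mul_of_nonneg_right (hβ.slope L) (hL L hLr)
    _ ≤ _ := by rw [← Finset.mul_sum]; exact mul_le_mul_of_nonneg_left (h2 n le_rfl) hB

end Abstract

section Bilinear

set_option linter.unusedSectionVars false

variable {ι : Type*} [DecidableEq ι]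

/-- The totient of a squarefree product, given by its finite set of prime factors. -/
def setTotient (N : ι → ℝ) (D : Finset ι) : ℝ := ∏ p ∈ D, (N p - 1)

/-- The Selberg form `∑ μ(d) μ(e) β(deg d) β'(deg e) / |[d, e]|`. -/
def bilinSum (N : ι → ℝ) (deg : ι → ℕ) (R : Finset ι) (β β' : ℕ → ℝ) : ℝ :=
  ∑ d ∈ R.powerset, ∑ e ∈ R.powerset,
    (-1) ^ (d.card + e.card) / setNorm N (d ∪ e) * (β (setDeg deg d) * β' (setDeg deg e))

variable {N : ι → ℝ} {deg : ι → ℕ} {P : Finset ι} {n : ℕ}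

theorem setTotient_pos {D : Finset ι} (h : ∀ p ∈ D, 2 ≤ N p) : 0 < setTotient N D :=
  Finset.prod_pos fun p hp => by linarith [h p hp]

theorem setNorm_eq_sum_setTotient (D : Finset ι) :
    setNorm N D = ∑ u ∈ D.powerset, setTotient N u := by
  unfold setNorm setTotient
  rw [← Finset.prod_one_add]
  simp

theorem eulerFactor_eq_div {D : Finset ι} (h : ∀ p ∈ D, 2 ≤ N p) :
    eulerFactor N D = setNorm N D / setTotient N D := by
  unfold eulerFactor setNorm setTotient
  rw [← Finset.prod_div_distrib]
  refine Finset.prod_congr rfl fun p hp => ?_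
  have h1 : N p ≠ 0 := by linarith [h p hp]
  have h2 : N p - 1 ≠ 0 := by linarith [h p hp]
  field_simp

theorem sum_powerset_superset {M : Type*} [AddCommMonoid M] {R u : Finset ι} (hu : u ⊆ R)
    (f : Finset ι → M) :
    (∑ d ∈ R.powerset, if u ⊆ d then f d else 0) = ∑ d ∈ (R \ u).powerset, f (u ∪ d) := by
  have hd : Disjoint u (R \ u) := Finset.disjoint_sdiff
  conv_lhs => rw [← Finset.union_sdiff_of_subset hu]
  rw [sum_powerset_union hd, Finset.sum_eq_single u]
  · simp
  · intro a ha hau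
    refine Finset.sum_eq_zero fun b hb => if_neg fun hsub => hau ?_
    refine Finset.Subset.antisymm (Finset.mem_powerset.1 ha) fun x hx => ?_
    rcases Finset.mem_union.1 (hsub hx) with h | h
    · exact h
    · exact absurd hx (Finset.mem_sdiff.1 (Finset.mem_powerset.1 hb h)).2
  · intro h; simp at h

theorem one_div_setNorm_union {R d e : Finset ι} (hR : ∀ p ∈ R, 2 ≤ N p) (hd : d ⊆ R)
    (he : e ⊆ R) :
    1 / setNorm N (d ∪ e) = ∑ u ∈ R.powerset, setTotient N u *
      ((if u ⊆ d then 1 / setNorm N d else 0) * (if u ⊆ e then 1 / setNorm N e else 0)) := by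
  have h1 : setNorm N (d ∪ e) * setNorm N (d ∩ e) = setNorm N d * setNorm N e :=
    Finset.prod_union_inter
  have hpd := setNorm_pos fun p hp => hR p (hd hp)
  have hpe := setNorm_pos fun p hp => hR p (he hp)
  have hpu := setNorm_pos fun p (hp : p ∈ d ∪ e) => hR p (Finset.union_subset hd he hp)
  have h2 : 1 / setNorm N (d ∪ e) = setNorm N (d ∩ e) * (1 / setNorm N d * (1 / setNorm N e)) := by
    field_simp
    linarith
  rw [h2, setNorm_eq_sum_setTotient (d ∩ e), Finset.sum_mul]
  have h3 : (d ∩ e).powerset = R.powerset.filter (fun u => u ⊆ d ∧ u ⊆ e) := by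
    ext u
    simp only [Finset.mem_powerset, Finset.mem_filter, Finset.subset_inter_iff]
    exact ⟨fun h => ⟨h.1.trans hd, h⟩, fun h => h.2⟩
  rw [h3, Finset.sum_filter]
  refine Finset.sum_congr rfl fun u _ => ?_
  by_cases h : u ⊆ d <;> by_cases h' : u ⊆ e <;> simp [h, h']

theorem sum_superset_eq_linearSum {R u : Finset ι} (hu : u ⊆ R) (β : ℕ → ℝ) :
    (∑ d ∈ R.powerset, (-1) ^ d.card * (if u ⊆ d then 1 / setNorm N d else 0) *
      β (setDeg deg d)) =
    (-1) ^ u.card / setNorm N u *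
      linearSum N deg (R \ u) (fun x => β (x + setDeg deg u)) := by
  have : ∀ d ∈ R.powerset, (-1 : ℝ) ^ d.card * (if u ⊆ d then 1 / setNorm N d else 0) *
      β (setDeg deg d) =
      if u ⊆ d then (-1 : ℝ) ^ d.card * (1 / setNorm N d) * β (setDeg deg d) else 0 := by
    intro d _; split_ifs <;> simp
  rw [Finset.sum_congr rfl this, sum_powerset_superset hu]
  unfold linearSum
  rw [Finset.mul_sum]
  refine Finset.sum_congr rfl fun d hd => ?_
  have hdis : Disjoint u d :=
    Finset.disjoint_sdiff.mono_right (Finset.mem_powerset.1 hd)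
  rw [setNorm_union hdis, setDeg_union hdis, Finset.card_union_of_disjoint hdis, pow_add,
    add_comm (setDeg deg u)]
  field_simp

/-- The Selberg form is diagonal in the variables `∑_{u ∣ d} μ(d) β(deg d) / |d|`. -/
theorem bilinSum_eq {R : Finset ι} (hR : ∀ p ∈ R, 2 ≤ N p) (β β' : ℕ → ℝ) :
    bilinSum N deg R β β' = ∑ u ∈ R.powerset, setTotient N u / setNorm N u ^ 2 *
      (linearSum N deg (R \ u) (fun x => β (x + setDeg deg u)) *
        linearSum N deg (R \ u) (fun x => β' (x + setDeg deg u))) := by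
  have h1 : bilinSum N deg R β β' = ∑ d ∈ R.powerset, ∑ e ∈ R.powerset, ∑ u ∈ R.powerset,
      setTotient N u *
      (((-1) ^ d.card * (if u ⊆ d then 1 / setNorm N d else 0) * β (setDeg deg d)) *
       ((-1) ^ e.card * (if u ⊆ e then 1 / setNorm N e else 0) * β' (setDeg deg e))) := by
    unfold bilinSum
    refine Finset.sum_congr rfl fun d hd => Finset.sum_congr rfl fun e he => ?_
    rw [div_eq_mul_one_div, one_div_setNorm_union hR (Finset.mem_powerset.1 hd)
      (Finset.mem_powerset.1 he), Finset.mul_sum, Finset.sum_mul]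
    refine Finset.sum_congr rfl fun u _ => ?_
    rw [pow_add]; ring
  rw [h1]
  have h2 : ∀ d ∈ R.powerset, (∑ e ∈ R.powerset, ∑ u ∈ R.powerset,
      setTotient N u *
      (((-1) ^ d.card * (if u ⊆ d then 1 / setNorm N d else 0) * β (setDeg deg d)) *
       ((-1) ^ e.card * (if u ⊆ e then 1 / setNorm N e else 0) * β' (setDeg deg e)))) =
      ∑ u ∈ R.powerset, setTotient N u *
      (((-1) ^ d.card * (if u ⊆ d then 1 / setNorm N d else 0) * β (setDeg deg d)) *
      ∑ e ∈ R.powerset,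
       ((-1) ^ e.card * (if u ⊆ e then 1 / setNorm N e else 0) * β' (setDeg deg e))) := by
    intro d _
    rw [Finset.sum_comm]
    refine Finset.sum_congr rfl fun u _ => ?_
    rw [Finset.mul_sum, Finset.mul_sum]
  rw [Finset.sum_congr rfl h2, Finset.sum_comm]
  refine Finset.sum_congr rfl fun u hu => ?_
  rw [← Finset.mul_sum, ← Finset.sum_mul, sum_superset_eq_linearSum (Finset.mem_powerset.1 hu),
    sum_superset_eq_linearSum (Finset.mem_powerset.1 hu)]
  have hpos := setNorm_pos fun p hp => hR p (Finset.mem_powerset.1 hu hp)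
  have : ((-1 : ℝ) ^ u.card) * (-1) ^ u.card = 1 := by
    rw [← pow_add, ← two_mul, pow_mul]; simp
  calc _ = setTotient N u / setNorm N u ^ 2 * (((-1 : ℝ) ^ u.card) * (-1) ^ u.card) *
      (linearSum N deg (R \ u) (fun x => β (x + setDeg deg u)) *
        linearSum N deg (R \ u) (fun x => β' (x + setDeg deg u))) := by ring
    _ = _ := by rw [this, mul_one]

theorem prod_one_add_sq_le (hsq : ∑ p ∈ P, 1 / N p ^ 2 ≤ 1) {c : ℝ} (hc : 0 ≤ c)
    {R : Finset ι} (hR : R ⊆ P) :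
    ∏ p ∈ R, (1 + c / N p ^ 2) ≤ Real.exp c := by
  refine (Real.prod_one_add_le_exp_sum R fun p => by positivity).trans ?_
  rw [Real.exp_le_exp]
  calc ∑ p ∈ R, c / N p ^ 2 = c * ∑ p ∈ R, 1 / N p ^ 2 := by
        rw [Finset.mul_sum]; exact Finset.sum_congr rfl fun p _ => by ring
    _ ≤ c * ∑ p ∈ P, 1 / N p ^ 2 := by
        gcongr
    _ ≤ c * 1 := by gcongr
    _ = c := mul_one c

theorem PrimeSystem.sum_one_div_setNorm_le (hP : PrimeSystem N deg P n) {R V : Finset ι}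
    (hR : R ⊆ P) (hV : V ⊆ P) (hRV : Disjoint R V) (l : ℕ) :
    (∑ u ∈ R.powerset, if setDeg deg u ≤ l then 1 / setNorm N u else 0) ≤
      Real.exp 2 * (eulerFactor N V)⁻¹ * (l + setDeg deg V + 1) := by
  set S := ∑ u ∈ R.powerset, if setDeg deg u ≤ l then 1 / setNorm N u else 0 with hS
  have hNV : ∀ p ∈ V, 2 ≤ N p := fun p hp => hP.two_le p (hV hp)
  have hS0 : 0 ≤ S := Finset.sum_nonneg fun u hu => by
    split_ifs
    · exact one_div_nonneg.2 (setNorm_pos fun p hp =>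
        hP.two_le p (hR (Finset.mem_powerset.1 hu hp))).le
    · exact le_rfl
  have h1 : S * ∏ p ∈ V, (1 + 1 / N p) ≤ l + setDeg deg V + 1 := by
    have hc := hP.count (l + setDeg deg V)
    push_cast at hc
    refine le_trans ?_ hc
    rw [Finset.prod_one_add, hS, Finset.sum_mul]
    have hsub : (R ∪ V).powerset ⊆ P.powerset :=
      Finset.powerset_mono.2 (Finset.union_subset hR hV)
    refine le_trans ?_ (Finset.sum_le_sum_of_subset_of_nonneg hsub fun D hD _ => ?_)
    · rw [sum_powerset_union hRV]
      refine Finset.sum_le_sum fun u hu => ?_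
      rw [Finset.mul_sum]
      refine Finset.sum_le_sum fun v hv => ?_
      have hdis : Disjoint u v :=
        (hRV.mono_left (Finset.mem_powerset.1 hu)).mono_right (Finset.mem_powerset.1 hv)
      have hv' : setDeg deg v ≤ setDeg deg V :=
        Finset.sum_le_sum_of_subset (Finset.mem_powerset.1 hv)
      have hvp : ∏ i ∈ v, 1 / N i = 1 / setNorm N v := by
        rw [setNorm, Finset.prod_div_distrib]; simp
      have hpos : 0 < setNorm N (u ∪ v) := setNorm_pos fun p hp => hP.two_le p
        (Finset.mem_powerset.1 (hsub (Finset.mem_powerset.2 (Finset.union_subset_union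
          (Finset.mem_powerset.1 hu) (Finset.mem_powerset.1 hv)))) hp)
      rw [hvp, setDeg_union hdis]
      by_cases hul : setDeg deg u ≤ l
      · rw [if_pos hul, if_pos (by omega), setNorm_union hdis]
        exact le_of_eq (by rw [div_mul_div_comm, one_mul])
      · rw [if_neg hul, zero_mul]
        split_ifs
        · positivity
        · exact le_rfl
    · split_ifs
      · exact one_div_nonneg.2 (setNorm_pos fun p hp =>
          hP.two_le p (Finset.mem_powerset.1 hD hp)).le
      · exact le_rfl
  have h2 : eulerFactor N V ≤ Real.exp 2 * ∏ p ∈ V, (1 + 1 / N p) := by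
    have : eulerFactor N V ≤ (∏ p ∈ V, (1 + 2 / N p ^ 2)) * ∏ p ∈ V, (1 + 1 / N p) := by
      unfold eulerFactor
      rw [← Finset.prod_mul_distrib]
      refine Finset.prod_le_prod (fun p hp => ?_) fun p hp => ?_
      all_goals
        have h2 := hNV p hp
        have : 1 / N p ≤ 1 / 2 := one_div_le_one_div_of_le (by norm_num) h2
      · exact inv_nonneg.2 (by linarith)
      · have h0 : 0 < 1 / N p := by positivity
        have e : 2 / N p ^ 2 = 2 * (1 / N p) ^ 2 := by ring
        rw [e]
        set x := 1 / N p
        rw [inv_le_iff_one_le_mul₀ (by linarith)]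
        nlinarith [mul_nonneg (sq_nonneg x) (by nlinarith : (0:ℝ) ≤ 1 - 2 * x ^ 2)]
    refine this.trans ?_
    have hp : 0 ≤ ∏ p ∈ V, (1 + 1 / N p) := Finset.prod_nonneg fun p hp => by
      have := hNV p hp; positivity
    exact mul_le_mul_of_nonneg_right (prod_one_add_sq_le hP.sum_sq (by norm_num) hV) hp
  have hE : 0 < eulerFactor N V := by linarith [one_le_eulerFactor hNV]
  rw [mul_comm (Real.exp 2), mul_assoc, inv_mul_eq_div, le_div_iff₀ hE]
  calc S * eulerFactor N V ≤ S * (Real.exp 2 * ∏ p ∈ V, (1 + 1 / N p)) := by gcongr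
    _ = Real.exp 2 * (S * ∏ p ∈ V, (1 + 1 / N p)) := by ring
    _ ≤ _ := by gcongr

theorem PrimeSystem.sum_one_div_setTotient_le (hP : PrimeSystem N deg P n) {R V : Finset ι}
    (hR : R ⊆ P) (hV : V ⊆ P) (hRV : Disjoint R V) (l : ℕ) :
    (∑ u ∈ R.powerset, if setDeg deg u ≤ l then 1 / setTotient N u else 0) ≤
      Real.exp 4 * (eulerFactor N V)⁻¹ * (l + setDeg deg V + 1) := by
  have hN : ∀ u ∈ R.powerset, ∀ p ∈ u, 2 ≤ N p := fun u hu p hp =>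
    hP.two_le p (hR (Finset.mem_powerset.1 hu hp))
  have h1 : ∀ u ∈ R.powerset, 1 / setTotient N u =
      1 / setNorm N u * ∑ x ∈ R.powerset, if x ⊆ u then 1 / setTotient N x else 0 := by
    intro u hu
    have e1 : (∑ x ∈ R.powerset, if x ⊆ u then 1 / setTotient N x else 0) =
        ∏ p ∈ u, (1 + 1 / (N p - 1)) := by
      rw [Finset.prod_one_add, ← Finset.sum_filter]
      have : R.powerset.filter (· ⊆ u) = u.powerset := by
        ext x
        simp only [Finset.mem_filter, Finset.mem_powerset]
        exact ⟨fun h => h.2, fun h => ⟨h.trans (Finset.mem_powerset.1 hu), h⟩⟩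
      rw [this]
      refine Finset.sum_congr rfl fun x _ => ?_
      rw [setTotient, Finset.prod_div_distrib]; simp
    have e2 : ∏ p ∈ u, (1 + 1 / (N p - 1)) = setNorm N u / setTotient N u := by
      unfold setNorm setTotient
      rw [← Finset.prod_div_distrib]
      refine Finset.prod_congr rfl fun p hp => ?_
      have h2 : N p - 1 ≠ 0 := by linarith [hN u hu p hp]
      field_simp; ring
    rw [e1, e2]
    have := setNorm_pos (hN u hu)
    field_simp
  set T := ∑ u ∈ R.powerset, if setDeg deg u ≤ l then 1 / setNorm N u else 0 with hT
  have h2 : (∑ u ∈ R.powerset, if setDeg deg u ≤ l then 1 / setTotient N u else 0) =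
      ∑ x ∈ R.powerset, 1 / setTotient N x * ∑ u ∈ R.powerset,
        if x ⊆ u then (if setDeg deg u ≤ l then 1 / setNorm N u else 0) else 0 := by
    have : ∀ u ∈ R.powerset, (if setDeg deg u ≤ l then 1 / setTotient N u else 0) =
        ∑ x ∈ R.powerset, 1 / setTotient N x *
          if x ⊆ u then (if setDeg deg u ≤ l then 1 / setNorm N u else 0) else 0 := by
      intro u hu
      by_cases hul : setDeg deg u ≤ l
      · simp only [hul, if_true]
        rw [h1 u hu, Finset.mul_sum]
        refine Finset.sum_congr rfl fun x _ => ?_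
        split_ifs
        · ring
        · simp
      · simp [hul]
    rw [Finset.sum_congr rfl this, Finset.sum_comm]
    refine Finset.sum_congr rfl fun x _ => ?_
    rw [Finset.mul_sum]
  have h3 : ∀ x ∈ R.powerset, (∑ u ∈ R.powerset,
        if x ⊆ u then (if setDeg deg u ≤ l then 1 / setNorm N u else 0) else 0) ≤
        1 / setNorm N x * T := by
    intro x hx
    rw [sum_powerset_superset (Finset.mem_powerset.1 hx), hT, Finset.mul_sum]
    have hsub : (R \ x).powerset ⊆ R.powerset := Finset.powerset_mono.2 Finset.sdiff_subset
    refine le_trans ?_ (Finset.sum_le_sum_of_subset_of_nonneg hsub fun u hu _ => ?_)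
    · refine Finset.sum_le_sum fun u hu => ?_
      have hdis : Disjoint x u :=
        Finset.disjoint_sdiff.mono_right (Finset.mem_powerset.1 hu)
      have p1 := setNorm_pos (hN x hx)
      have p2 := setNorm_pos (hN u (hsub hu))
      rw [setDeg_union hdis, setNorm_union hdis]
      by_cases hul : setDeg deg u ≤ l
      · rw [if_pos hul]
        split_ifs
        · exact le_of_eq (by rw [div_mul_div_comm, one_mul])
        · positivity
      · rw [if_neg hul, if_neg (by omega), mul_zero]
    · have p1 := setNorm_pos (hN x hx)
      have p2 := setNorm_pos (hN u hu)
      split_ifs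
      · positivity
      · simp
  have hT0 := hP.sum_one_div_setNorm_le hR hV hRV l
  have hTnn : 0 ≤ T := Finset.sum_nonneg fun u hu => by
    have p2 := setNorm_pos (hN u hu)
    split_ifs
    · positivity
    · exact le_rfl
  rw [h2]
  calc _ ≤ ∑ x ∈ R.powerset, 1 / setTotient N x * (1 / setNorm N x * T) :=
        Finset.sum_le_sum fun x hx => mul_le_mul_of_nonneg_left (h3 x hx)
          (one_div_nonneg.2 (setTotient_pos (hN x hx)).le)
    _ = (∏ p ∈ R, (1 + 1 / (N p - 1) * (1 / N p))) * T := by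
        rw [Finset.prod_one_add, Finset.sum_mul]
        refine Finset.sum_congr rfl fun x _ => ?_
        rw [Finset.prod_mul_distrib, Finset.prod_div_distrib, Finset.prod_div_distrib,
          setTotient, setNorm]
        simp; ring
    _ ≤ Real.exp 2 * T := by
        refine mul_le_mul_of_nonneg_right (le_trans (Finset.prod_le_prod (fun p hp => ?_)
          fun p hp => ?_) (prod_one_add_sq_le hP.sum_sq (c := 2) (by norm_num) hR)) hTnn
        · have := hP.two_le p (hR hp)
          have : 0 < N p - 1 := by linarith
          positivity
        · have h2 := hP.two_le p (hR hp)
          have h3 : 0 < N p - 1 := by linarith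
          have h4 : 0 < N p := by linarith
          rw [div_mul_div_comm, one_mul]
          gcongr 1 + ?_
          rw [div_le_div_iff₀ (by positivity) (by positivity)]
          nlinarith
    _ ≤ Real.exp 2 * (Real.exp 2 * (eulerFactor N V)⁻¹ * (l + setDeg deg V + 1)) := by gcongr
    _ = _ := by
        rw [← mul_assoc, ← mul_assoc, ← Real.exp_add]; norm_num

/-- Upper bound for the Selberg form over primes outside `V`, with `V₀ ⊆ V`. -/
theorem PrimeSystem.abs_bilinSum_le (hP : PrimeSystem N deg P n) {V V₀ : Finset ι} (hV : V ⊆ P)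
    (hV₀ : V₀ ⊆ V) {β β' : ℕ → ℝ} {l : ℕ} {B : ℝ} (hβ : SlopeBound β l B)
    (hβ' : SlopeBound β' l B) (hl : l ≤ n) (hB : 0 ≤ B) :
    |bilinSum N deg (P \ V) β β'| ≤ Real.exp 4 * B ^ 2 * eulerFactor N V ^ 2 *
      (eulerFactor N V₀)⁻¹ * (l + setDeg deg V₀ + 1) := by
  set R := P \ V with hR
  have hRP : R ⊆ P := Finset.sdiff_subset
  have hN : ∀ p ∈ R, 2 ≤ N p := fun p hp => hP.two_le p (hRP hp)
  have hdisj : Disjoint R V₀ := Finset.sdiff_disjoint.mono_right hV₀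
  rw [bilinSum_eq hN]
  have hlin : ∀ u ∈ R.powerset, ∀ γ : ℕ → ℝ, SlopeBound γ l B →
      0 ≤ linearSum N deg (R \ u) (fun x => γ (x + setDeg deg u)) ∧
      linearSum N deg (R \ u) (fun x => γ (x + setDeg deg u)) ≤
        B * (eulerFactor N V * (setNorm N u / setTotient N u)) ∧
      (l < setDeg deg u → linearSum N deg (R \ u) (fun x => γ (x + setDeg deg u)) = 0) := by
    intro u hu γ hγ
    have huR := Finset.mem_powerset.1 hu
    have hdis : Disjoint V u := Finset.disjoint_sdiff.mono_right huR
    have e : R \ u = P \ (V ∪ u) := by rw [hR, sdiff_sdiff_left]; rfl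
    have := hP.linearSum_mem (Finset.union_subset hV (huR.trans hRP)) (hγ.shift (setDeg deg u))
      hl hB
    rw [← e, eulerFactor_union hdis, eulerFactor_eq_div (D := u) fun p hp => hN p (huR hp)] at this
    refine ⟨this.1, this.2, fun h => ?_⟩
    unfold linearSum
    exact Finset.sum_eq_zero fun D _ => by
      beta_reduce
      rw [hγ.supp _ (by omega), mul_zero]
  have hE : 0 ≤ eulerFactor N V :=
    zero_le_one.trans (one_le_eulerFactor fun p hp => hP.two_le p (hV hp))
  have hterm : ∀ u ∈ R.powerset, |setTotient N u / setNorm N u ^ 2 *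
      (linearSum N deg (R \ u) (fun x => β (x + setDeg deg u)) *
        linearSum N deg (R \ u) (fun x => β' (x + setDeg deg u)))| ≤
      B ^ 2 * eulerFactor N V ^ 2 * if setDeg deg u ≤ l then 1 / setTotient N u else 0 := by
    intro u hu
    obtain ⟨h1, h2, h3⟩ := hlin u hu β hβ
    obtain ⟨h1', h2', h3'⟩ := hlin u hu β' hβ'
    have huN : ∀ p ∈ u, 2 ≤ N p := fun p hp => hN p (Finset.mem_powerset.1 hu hp)
    have hA := setNorm_pos huN
    have hφ := setTotient_pos huN
    rw [abs_of_nonneg (by positivity)]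
    split_ifs with hul
    · calc _ ≤ setTotient N u / setNorm N u ^ 2 *
          ((B * (eulerFactor N V * (setNorm N u / setTotient N u))) *
           (B * (eulerFactor N V * (setNorm N u / setTotient N u)))) := by gcongr
        _ = _ := by field_simp
    · rw [h3 (by omega)]; simp
  refine (Finset.abs_sum_le_sum_abs _ _).trans ((Finset.sum_le_sum hterm).trans ?_)
  rw [← Finset.mul_sum]
  calc _ ≤ B ^ 2 * eulerFactor N V ^ 2 *
      (Real.exp 4 * (eulerFactor N V₀)⁻¹ * (l + setDeg deg V₀ + 1)) := by
        gcongr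
        exact hP.sum_one_div_setTotient_le hRP (hV₀.trans hV) hdisj l
    _ = _ := by ring

/-- Upper bound for the part of the Selberg form with `s ∣ [d, e]`. -/
theorem PrimeSystem.abs_bilinSum_superset_le (hP : PrimeSystem N deg P n) {V V₀ s : Finset ι}
    (hV : V ⊆ P) (hV₀ : V₀ ⊆ V) (hs : s ⊆ P \ V) {β : ℕ → ℝ} {l : ℕ} {B : ℝ}
    (hβ : SlopeBound β l B) (hl : l ≤ n) (hB : 0 ≤ B) :
    |∑ d ∈ (P \ V).powerset, ∑ e ∈ (P \ V).powerset, if s ⊆ d ∪ e then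
      (-1) ^ (d.card + e.card) / setNorm N (d ∪ e) * (β (setDeg deg d) * β (setDeg deg e))
      else 0| ≤
    (∏ p ∈ s, 16 / N p) * (Real.exp 4 * B ^ 2 * eulerFactor N V ^ 2 *
      (eulerFactor N V₀)⁻¹ * (l + setDeg deg V₀ + 1)) := by
  set R := P \ V with hR
  have hRP : R ⊆ P := Finset.sdiff_subset
  have hN : ∀ p ∈ R, 2 ≤ N p := fun p hp => hP.two_le p (hRP hp)
  have hds : Disjoint s (R \ s) := Finset.disjoint_sdiff
  have hdVs : Disjoint V s := Finset.disjoint_sdiff.mono_right hs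
  have hsN : ∀ p ∈ s, 2 ≤ N p := fun p hp => hN p (hs hp)
  have hA := setNorm_pos hsN
  set K := Real.exp 4 * B ^ 2 * eulerFactor N V ^ 2 *
      (eulerFactor N V₀)⁻¹ * (l + setDeg deg V₀ + 1) with hK
  have hE₀ : 1 ≤ eulerFactor N V₀ := one_le_eulerFactor fun p hp => hP.two_le p (hV (hV₀ hp))
  have hE : 1 ≤ eulerFactor N V := one_le_eulerFactor fun p hp => hP.two_le p (hV hp)
  have hK0 : 0 ≤ K := by positivity
  have hbil : ∀ a b : ℕ, |bilinSum N deg (R \ s) (fun x => β (x + a)) (fun x => β (x + b))| ≤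
      4 ^ s.card * K := by
    intro a b
    have e : R \ s = P \ (V ∪ s) := by rw [hR, sdiff_sdiff_left]; rfl
    rw [e]
    refine (hP.abs_bilinSum_le (Finset.union_subset hV (hs.trans hRP))
      (hV₀.trans Finset.subset_union_left) (hβ.shift a) (hβ.shift b) hl hB).trans ?_
    rw [eulerFactor_union hdVs, mul_pow]
    have h2 : eulerFactor N s ^ 2 ≤ 4 ^ s.card := by
      calc eulerFactor N s ^ 2 ≤ (2 ^ s.card) ^ 2 := by
            have := one_le_eulerFactor hsN
            gcongr
            exact eulerFactor_le_two_pow hsN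
        _ = 4 ^ s.card := by rw [← pow_mul, mul_comm, pow_mul]; norm_num
    calc _ = eulerFactor N s ^ 2 * K := by rw [hK]; ring
      _ ≤ _ := by gcongr
  have hdecomp : (∑ d ∈ R.powerset, ∑ e ∈ R.powerset, if s ⊆ d ∪ e then
      (-1) ^ (d.card + e.card) / setNorm N (d ∪ e) * (β (setDeg deg d) * β (setDeg deg e))
      else 0) = ∑ a ∈ s.powerset, ∑ b ∈ s.powerset, if a ∪ b = s then
        (-1) ^ (a.card + b.card) / setNorm N s * bilinSum N deg (R \ s)
          (fun x => β (x + setDeg deg a)) (fun x => β (x + setDeg deg b)) else 0 := by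
    conv_lhs => rw [← Finset.union_sdiff_of_subset hs]
    rw [sum_powerset_union hds]
    simp_rw [sum_powerset_union hds]
    refine Finset.sum_congr rfl fun a ha => ?_
    rw [Finset.sum_comm]
    refine Finset.sum_congr rfl fun b hb => ?_
    have has := Finset.mem_powerset.1 ha
    have hbs := Finset.mem_powerset.1 hb
    by_cases hab : a ∪ b = s
    · rw [if_pos hab]
      unfold bilinSum
      rw [Finset.mul_sum]
      refine Finset.sum_congr rfl fun d hd => ?_
      rw [Finset.mul_sum]
      refine Finset.sum_congr rfl fun e he => ?_
      have hd' := Finset.mem_powerset.1 hd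
      have he' := Finset.mem_powerset.1 he
      have h1 : a ∪ d ∪ (b ∪ e) = s ∪ (d ∪ e) := by
        rw [← hab]; ext x; simp only [Finset.mem_union]; tauto
      have d1 : Disjoint s (d ∪ e) := hds.mono_right (Finset.union_subset hd' he')
      have d2 : Disjoint a d := (hds.mono_left has).mono_right hd'
      have d3 : Disjoint b e := (hds.mono_left hbs).mono_right he'
      rw [h1, if_pos Finset.subset_union_left, setNorm_union d1, setDeg_union d2, setDeg_union d3,
        Finset.card_union_of_disjoint d2, Finset.card_union_of_disjoint d3,
        add_comm (setDeg deg a), add_comm (setDeg deg b)]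
      have hA' : 0 < setNorm N (d ∪ e) := setNorm_pos fun p hp =>
        hN p (Finset.sdiff_subset (Finset.union_subset hd' he' hp))
      field_simp
      ring
    · rw [if_neg hab]
      refine Finset.sum_eq_zero fun d hd => Finset.sum_eq_zero fun e he => if_neg fun hsub => hab ?_
      refine Finset.Subset.antisymm (Finset.union_subset has hbs) fun x hx => ?_
      have hd' := Finset.mem_powerset.1 hd
      have he' := Finset.mem_powerset.1 he
      have hxd : x ∉ d := fun h => (Finset.mem_sdiff.1 (hd' h)).2 hx
      have hxe : x ∉ e := fun h => (Finset.mem_sdiff.1 (he' h)).2 hx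
      have := hsub hx
      simp only [Finset.mem_union] at this ⊢
      tauto
  rw [hdecomp]
  have hbound : ∀ a ∈ s.powerset, ∀ b ∈ s.powerset, |if a ∪ b = s then
        (-1) ^ (a.card + b.card) / setNorm N s * bilinSum N deg (R \ s)
          (fun x => β (x + setDeg deg a)) (fun x => β (x + setDeg deg b)) else 0| ≤
        1 / setNorm N s * (4 ^ s.card * K) := by
    intro a _ b _
    split_ifs
    · rw [abs_mul, abs_div, abs_pow, abs_neg, abs_one, one_pow, abs_of_pos hA]
      gcongr
      exact hbil _ _
    · rw [abs_zero]; positivity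
  calc _ ≤ ∑ a ∈ s.powerset, ∑ b ∈ s.powerset, 1 / setNorm N s * (4 ^ s.card * K) :=
        (Finset.abs_sum_le_sum_abs _ _).trans (Finset.sum_le_sum fun a ha =>
          (Finset.abs_sum_le_sum_abs _ _).trans (Finset.sum_le_sum fun b hb => hbound a ha b hb))
    _ = (2 ^ s.card * 2 ^ s.card * 4 ^ s.card) * (1 / setNorm N s) * K := by
        simp only [Finset.sum_const, Finset.card_powerset, nsmul_eq_mul]
        push_cast; ring
    _ = _ := by
        rw [Finset.prod_div_distrib, Finset.prod_const, ← mul_pow, ← mul_pow, setNorm,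
          show (2 * 2 * 4 : ℝ) = 16 by norm_num]
        ring

end Bilinear

section Coupling

set_option linter.unusedSectionVars false

variable {ι : Type*} [DecidableEq ι]

/-- The Möbius transform of the indicator of the sets with at most one element. -/
def atMostOneCoeff {κ : Type*} (T : Finset κ) : ℝ := (-1) ^ T.card * (1 - T.card)

theorem sum_powerset_atMostOneCoeff {κ : Type*} [DecidableEq κ] (S : Finset κ) :
    ∑ T ∈ S.powerset, atMostOneCoeff T = if S.card ≤ 1 then 1 else 0 := by
  have hA : ∀ S : Finset κ, ∑ T ∈ S.powerset, (-1 : ℝ) ^ T.card = if S = ∅ then 1 else 0 := by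
    intro S
    have := Finset.sum_powerset_neg_one_pow_card (x := S)
    have h2 := congrArg (Int.cast : ℤ → ℝ) this
    push_cast at h2
    exact h2
  induction S using Finset.induction_on with
  | empty => simp [atMostOneCoeff]
  | insert a S ha _ =>
    rw [Finset.sum_powerset_insert ha, ← Finset.sum_add_distrib]
    have : ∀ T ∈ S.powerset, atMostOneCoeff T + atMostOneCoeff (insert a T) = (-1 : ℝ) ^ T.card := by
      intro T hT
      have haT : a ∉ T := fun h => ha (Finset.mem_powerset.1 hT h)
      unfold atMostOneCoeff
      rw [Finset.card_insert_of_notMem haT]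
      push_cast; ring
    rw [Finset.sum_congr rfl this, hA, Finset.card_insert_of_notMem ha]
    congr 1
    rw [eq_iff_iff, ← Finset.card_eq_zero]; omega

theorem abs_sum_atMostOne_aux {X κ : Type*} [Fintype κ] [DecidableEq κ] (D : Finset X) (Ψ : X → ℝ)
    (S : X → ι → Finset κ) (g : ι → ℝ) (M : ℝ) (Q : Finset ι) :
    ∀ P : Finset ι, Disjoint Q P → (∀ s : ι → Finset κ,
      |∑ x ∈ D, if ∀ p ∈ Q ∪ P, s p ⊆ S x p then Ψ x else 0| ≤
        M * ∏ p ∈ Q ∪ P, g p ^ (s p).card) →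
    ∀ s : ι → Finset κ,
      |∑ x ∈ D, if (∀ p ∈ Q, (S x p).card ≤ 1) ∧ ∀ p ∈ P, s p ⊆ S x p then Ψ x else 0| ≤
        M * ((∏ p ∈ Q, ∑ T : Finset κ, |atMostOneCoeff T| * g p ^ T.card) *
          ∏ p ∈ P, g p ^ (s p).card) := by
  induction Q using Finset.induction_on with
  | empty => intro P _ h s; simpa using h s
  | insert p Q hp ih =>
    intro P hQP h s
    have hpP : p ∉ P := Finset.disjoint_left.1 hQP (Finset.mem_insert_self p Q)
    have e : Q ∪ insert p P = insert p Q ∪ P := by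
      ext x; simp only [Finset.mem_union, Finset.mem_insert]; tauto
    have ih' := ih (insert p P) (by
      rw [Finset.disjoint_insert_right]
      exact ⟨hp, hQP.mono_left (Finset.subset_insert p Q)⟩) (by rw [e]; exact h)
    have hpt : ∀ x ∈ D, (if (∀ p' ∈ insert p Q, (S x p').card ≤ 1) ∧ ∀ p' ∈ P, s p' ⊆ S x p'
        then Ψ x else 0) = ∑ T : Finset κ, atMostOneCoeff T *
          if (∀ p' ∈ Q, (S x p').card ≤ 1) ∧
            ∀ p' ∈ insert p P, Function.update s p T p' ⊆ S x p' then Ψ x else 0 := by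
      intro x _
      have hc : ∀ T : Finset κ, (∀ p' ∈ insert p P, Function.update s p T p' ⊆ S x p') ↔
          T ⊆ S x p ∧ ∀ p' ∈ P, s p' ⊆ S x p' := by
        intro T
        rw [Finset.forall_mem_insert, Function.update_self]
        refine and_congr_right fun _ => forall₂_congr fun p' hp' => ?_
        have hne : p' ≠ p := by rintro rfl; exact hpP hp'
        rw [Function.update_of_ne hne]
      simp only [hc]
      simp only [Finset.forall_mem_insert]
      have hI := sum_powerset_atMostOneCoeff (S x p)
      have hps : (S x p).powerset = Finset.univ.filter (· ⊆ S x p) := by ext T; simp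
      rw [hps, Finset.sum_filter] at hI
      by_cases h1 : ∀ p' ∈ Q, (S x p').card ≤ 1
      · by_cases h2 : ∀ p' ∈ P, s p' ⊆ S x p'
        · simp only [and_iff_right h1, and_iff_left h2]
          calc _ = (if (S x p).card ≤ 1 then (1 : ℝ) else 0) * Ψ x := by
                by_cases h3 : (S x p).card ≤ 1
                · rw [if_pos ⟨h3, h1⟩, if_pos h3, one_mul]
                · rw [if_neg (fun h => h3 h.1), if_neg h3, zero_mul]
            _ = _ := by
              rw [← hI, Finset.sum_mul]
              exact Finset.sum_congr rfl fun T _ => by split_ifs <;> simp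
        · simp [h2]
      · simp [h1]
    rw [Finset.sum_congr rfl hpt, Finset.sum_comm]
    refine (Finset.abs_sum_le_sum_abs _ _).trans ?_
    rw [Finset.prod_insert hp]
    calc _ ≤ ∑ T : Finset κ, |atMostOneCoeff T| * (M *
          ((∏ p ∈ Q, ∑ T : Finset κ, |atMostOneCoeff T| * g p ^ T.card) *
          (g p ^ T.card * ∏ p ∈ P, g p ^ (s p).card))) := by
          refine Finset.sum_le_sum fun T _ => ?_
          rw [← Finset.mul_sum, abs_mul]
          refine mul_le_mul_of_nonneg_left ?_ (abs_nonneg _)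
          refine (ih' (Function.update s p T)).trans (le_of_eq ?_)
          rw [Finset.prod_insert hpP, Function.update_self]
          congr 3
          refine Finset.prod_congr rfl fun p' hp' => ?_
          have hne : p' ≠ p := by rintro rfl; exact hpP hp'
          rw [Function.update_of_ne hne]
      _ = _ := by
          rw [Finset.sum_mul, Finset.sum_mul, Finset.mul_sum]
          exact Finset.sum_congr rfl fun T _ => by ring

/-- If the sum over the `x` with `s p ⊆ S x p` is bounded by `M ∏ p, g p ^ |s p|` for all `s`,
then the sum over the `x` for which all `S x p` have at most one element is bounded by `M` times
an Euler product without linear terms in `g`. -/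
theorem abs_sum_atMostOne_le {X κ : Type*} [Fintype κ] [DecidableEq κ] (D : Finset X) (Ψ : X → ℝ)
    (S : X → ι → Finset κ) (g : ι → ℝ) (M : ℝ) (hM : 0 ≤ M) (Q : Finset ι)
    (hg : ∀ p ∈ Q, 0 ≤ g p ∧ g p ≤ 1)
    (h : ∀ s : ι → Finset κ, |∑ x ∈ D, if ∀ p ∈ Q, s p ⊆ S x p then Ψ x else 0| ≤
        M * ∏ p ∈ Q, g p ^ (s p).card) :
    |∑ x ∈ D, if ∀ p ∈ Q, (S x p).card ≤ 1 then Ψ x else 0| ≤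
      M * ∏ p ∈ Q, (1 + 2 ^ Fintype.card κ * Fintype.card κ * g p ^ 2) := by
  have := abs_sum_atMostOne_aux D Ψ S g M Q ∅ (Finset.disjoint_empty_right Q)
    (by simpa using h) (fun _ => ∅)
  simp only [Finset.notMem_empty, false_imp_iff, implies_true, and_true, Finset.prod_empty,
    mul_one] at this
  refine this.trans (mul_le_mul_of_nonneg_left ?_ hM)
  refine Finset.prod_le_prod (fun p hp => Finset.sum_nonneg fun T _ =>
    mul_nonneg (abs_nonneg _) (pow_nonneg (hg p hp).1 _)) fun p hp => ?_
  obtain ⟨h0, h1⟩ := hg p hp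
  calc ∑ T : Finset κ, |atMostOneCoeff T| * g p ^ T.card
      ≤ ∑ T : Finset κ, ((if T = ∅ then 1 else 0) + Fintype.card κ * g p ^ 2) := by
        refine Finset.sum_le_sum fun T _ => ?_
        have hk : (0 : ℝ) ≤ Fintype.card κ := by positivity
        unfold atMostOneCoeff
        rw [abs_mul, abs_pow, abs_neg, abs_one, one_pow, one_mul]
        rcases Nat.lt_or_ge T.card 1 with hT | hT
        · have : T = ∅ := by rw [← Finset.card_eq_zero]; omega
          subst this
          simp
          positivity
        · have hne : T ≠ ∅ := by rintro rfl; simp at hT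
          rw [if_neg hne, zero_add]
          rcases Nat.lt_or_ge T.card 2 with hT' | hT'
          · have : T.card = 1 := by omega
            rw [this]; simp; positivity
          · have hTk : (T.card : ℝ) ≤ Fintype.card κ := by exact_mod_cast Finset.card_le_univ T
            have hT2 : (2 : ℝ) ≤ T.card := by exact_mod_cast hT'
            rw [abs_of_nonpos (by linarith)]
            have := pow_le_pow_of_le_one h0 h1 hT'
            have h3 : 0 ≤ g p ^ T.card := by positivity
            gcongr
            linarith
    _ = _ := by
        rw [Finset.sum_add_distrib, Finset.sum_const, Finset.card_univ, Fintype.card_finset]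
        simp
        ring

variable {N : ι → ℝ} {deg : ι → ℕ} {P : Finset ι} {n : ℕ}

/-- Upper bound for the `k`-dimensional Selberg form in which the `[d_j, e_j]` are pairwise
coprime. -/
theorem PrimeSystem.abs_coupled_le (hP : PrimeSystem N deg P n) {k : ℕ} {V V₀ : Finset ι}
    (hV : V ⊆ P) (hV₀ : V₀ ⊆ V) {β : Fin k → ℕ → ℝ} {l : Fin k → ℕ} {B : Fin k → ℝ}
    (hβ : ∀ j, SlopeBound (β j) (l j) (B j)) (hl : ∀ j, l j ≤ n) (hB : ∀ j, 0 ≤ B j)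
    (hN : ∀ p ∈ P \ V, 16 ≤ N p) :
    |∑ x ∈ Fintype.piFinset (fun _ : Fin k => (P \ V).powerset ×ˢ (P \ V).powerset),
      if ∀ p ∈ P \ V, (Finset.univ.filter (fun j => p ∈ (x j).1 ∪ (x j).2)).card ≤ 1 then
        ∏ j, ((-1) ^ ((x j).1.card + (x j).2.card) / setNorm N ((x j).1 ∪ (x j).2) *
          (β j (setDeg deg (x j).1) * β j (setDeg deg (x j).2))) else 0| ≤
      (∏ j, (Real.exp 4 * B j ^ 2 * eulerFactor N V ^ 2 *
      (eulerFactor N V₀)⁻¹ * (l j + setDeg deg V₀ + 1))) * Real.exp (2 ^ k * k * 256) := by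
  set R := P \ V with hR
  have hRP : R ⊆ P := Finset.sdiff_subset
  have hE₀ : 1 ≤ eulerFactor N V₀ := one_le_eulerFactor fun p hp => hP.two_le p (hV (hV₀ hp))
  have hE : 1 ≤ eulerFactor N V := one_le_eulerFactor fun p hp => hP.two_le p (hV hp)
  have hK0 : ∀ j, 0 ≤ Real.exp 4 * B j ^ 2 * eulerFactor N V ^ 2 *
      (eulerFactor N V₀)⁻¹ * (l j + setDeg deg V₀ + 1) := fun j => by have := hB j; positivity
  have hKp := Finset.prod_nonneg fun j (_ : j ∈ Finset.univ) => hK0 j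
  have key := abs_sum_atMostOne_le
    (Fintype.piFinset (fun _ : Fin k => R.powerset ×ˢ R.powerset))
    (fun x => ∏ j, ((-1) ^ ((x j).1.card + (x j).2.card) / setNorm N ((x j).1 ∪ (x j).2) *
          (β j (setDeg deg (x j).1) * β j (setDeg deg (x j).2))))
    (fun x p => Finset.univ.filter (fun j => p ∈ (x j).1 ∪ (x j).2)) (fun p => 16 / N p) _ hKp R
    (fun p hp => ⟨by have := hN p hp; positivity, by
      have := hN p hp
      rw [div_le_one (by linarith)]; exact this⟩) ?_
  · refine key.trans (mul_le_mul_of_nonneg_left ?_ hKp)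
    rw [Fintype.card_fin]
    calc _ = ∏ p ∈ R, (1 + 2 ^ k * k * 256 / N p ^ 2) := by
          refine Finset.prod_congr rfl fun p _ => ?_
          rw [div_pow]; ring
      _ ≤ _ := prod_one_add_sq_le hP.sum_sq (by positivity) hRP
  · intro s
    set t : Fin k → Finset ι := fun j => R.filter (fun p => j ∈ s p) with ht
    have hiff : ∀ x : Fin k → Finset ι × Finset ι,
        (∀ p ∈ R, s p ⊆ Finset.univ.filter (fun j => p ∈ (x j).1 ∪ (x j).2)) ↔
        ∀ j, t j ⊆ (x j).1 ∪ (x j).2 := by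
      intro x
      constructor
      · intro h j p hp
        rw [ht, Finset.mem_filter] at hp
        have := h p hp.1 hp.2
        exact (Finset.mem_filter.1 this).2
      · intro h p hp j hj
        exact Finset.mem_filter.2 ⟨Finset.mem_univ _, h j (Finset.mem_filter.2 ⟨hp, hj⟩)⟩
    have hsum : (∑ x ∈ Fintype.piFinset (fun _ : Fin k => R.powerset ×ˢ R.powerset),
        if ∀ p ∈ R, s p ⊆ Finset.univ.filter (fun j => p ∈ (x j).1 ∪ (x j).2) then
        ∏ j, ((-1 : ℝ) ^ ((x j).1.card + (x j).2.card) / setNorm N ((x j).1 ∪ (x j).2) *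
          (β j (setDeg deg (x j).1) * β j (setDeg deg (x j).2))) else 0) =
        ∏ j, ∑ d ∈ R.powerset, ∑ e ∈ R.powerset, if t j ⊆ d ∪ e then
      (-1) ^ (d.card + e.card) / setNorm N (d ∪ e) *
        (β j (setDeg deg d) * β j (setDeg deg e)) else 0 := by
      simp_rw [← Finset.sum_product']
      rw [Finset.prod_univ_sum]
      refine Finset.sum_congr rfl fun x _ => ?_
      rw [if_congr (hiff x) rfl rfl]
      split_ifs with h
      · exact Finset.prod_congr rfl fun j _ => (if_pos (h j)).symm
      · push Not at h
        obtain ⟨j, hj⟩ := h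
        exact (Finset.prod_eq_zero (Finset.mem_univ j) (if_neg hj)).symm
    rw [hsum, Finset.abs_prod]
    have hprod : ∏ p ∈ R, (16 / N p) ^ (s p).card = ∏ j, ∏ p ∈ t j, 16 / N p := by
      simp_rw [ht, Finset.prod_filter]
      rw [Finset.prod_comm]
      refine Finset.prod_congr rfl fun p _ => ?_
      rw [Finset.prod_ite, Finset.prod_const_one, mul_one, Finset.prod_const]
      simp
    rw [hprod, mul_comm, ← Finset.prod_mul_distrib]
    exact Finset.prod_le_prod (fun j _ => abs_nonneg _) fun j _ =>
      hP.abs_bilinSum_superset_le hV hV₀ (Finset.filter_subset _ _) (hβ j) (hl j) (hB j)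

end Coupling

section Counting

set_option linter.unusedSectionVars false

open scoped Classical

variable (K : Type*) [Field K] [Fintype K]

/-- The monic polynomials of degree `n`, as a finite set. -/
def monicFinset (n : ℕ) : Finset K[X] := (finite_monicOfDegree K n).toFinset

/-- The primes of degree less than `w`, as a finite set. -/
def primesBelow (w : ℕ) : Finset K[X] := (finite_primes K w).toFinset

variable {K}

/-- The product of a finite set of primes. -/
def setProd (D : Finset K[X]) : K[X] := ∏ p ∈ D, p

theorem mem_monicFinset {n : ℕ} {f : K[X]} : f ∈ monicFinset K n ↔ f.Monic ∧ f.natDegree = n := by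
  simp [monicFinset, monicOfDegree]

theorem mem_primesBelow {w : ℕ} {p : K[X]} :
    p ∈ primesBelow K w ↔ IsPrimePoly p ∧ p.natDegree < w := by
  simp [primesBelow]

theorem two_le_card : (2 : ℝ) ≤ Fintype.card K := by
  exact_mod_cast Fintype.one_lt_card (α := K)

theorem card_degreeLT (m : ℕ) : Nat.card (degreeLT K m) = Fintype.card K ^ m := by
  rw [Nat.card_congr (degreeLTEquiv K m).toEquiv, Nat.card_eq_fintype_card]
  simp

theorem card_monicFinset (m : ℕ) : (monicFinset K m).card = Fintype.card K ^ m := by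
  rw [← card_degreeLT (K := K) m, monicFinset, 
    ← Set.ncard_eq_toFinset_card (monicOfDegree K m) (finite_monicOfDegree K m),
    ← Nat.card_coe_set_eq]
  refine Nat.card_congr ⟨fun f => ⟨f.1 - X ^ m, ?_⟩, fun g => ⟨X ^ m + g.1, ?_⟩, ?_, ?_⟩
  · rw [mem_degreeLT]
    have h1 := f.2.1
    have h2 : f.1.natDegree = m := f.2.2
    have h3 : f.1.degree = (X ^ m : K[X]).degree := by
      rw [degree_X_pow, degree_eq_natDegree h1.ne_zero, h2]
    have h4 := degree_sub_lt_left h3 h1.ne_zero (by rw [h1.leadingCoeff, leadingCoeff_X_pow])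
    rwa [h3, degree_X_pow] at h4
  · have hg := mem_degreeLT.1 g.2
    have h1 : (X ^ m + g.1).Monic := monic_X_pow_add hg
    refine ⟨h1, ?_⟩
    have : (X ^ m + g.1).degree = (m : WithBot ℕ) := by
      rw [degree_add_eq_left_of_degree_lt (by rwa [degree_X_pow]), degree_X_pow]
    exact natDegree_eq_of_degree_eq_some this
  · intro f; ext1; simp
  · intro g; ext1; simp

/-- Monic polynomials of degree `n` are equidistributed modulo `M` if `deg M ≤ n`. -/
theorem card_monicFinset_filter {M : K[X]} (hM : M.Monic) {n : ℕ} (hn : M.natDegree ≤ n)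
    (a : K[X]) :
    ((monicFinset K n).filter (fun f => M ∣ f - a)).card =
      Fintype.card K ^ (n - M.natDegree) := by
  rw [← card_monicFinset]
  symm
  have hlt : (a %ₘ M).degree < M.degree := degree_modByMonic_lt a hM
  have hdvd : M ∣ a - a %ₘ M := ⟨a /ₘ M, by
    rw [sub_eq_iff_eq_add, add_comm]; exact (modByMonic_add_div a M).symm⟩
  have hmon : ∀ g ∈ monicFinset K (n - M.natDegree), (a %ₘ M).degree < (M * g).degree := by
    intro g hg
    have hg := mem_monicFinset.1 hg
    refine hlt.trans_le ?_
    rw [hM.degree_mul_comm, degree_mul]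
    rw [degree_eq_natDegree hM.ne_zero, degree_eq_natDegree hg.1.ne_zero]
    norm_cast; omega
  refine Finset.card_nbij' (fun g => a %ₘ M + M * g) (fun f => (f - a %ₘ M) /ₘ M) ?_ ?_ ?_ ?_
  · intro g hg
    have hd := hmon g hg
    have hg := mem_monicFinset.1 hg
    simp only [Finset.coe_filter, Set.mem_ofPred_eq]
    refine ⟨mem_monicFinset.2 ⟨?_, ?_⟩, ?_⟩
    · exact (hM.mul hg.1).add_of_right hd
    · rw [natDegree_add_eq_right_of_degree_lt hd, hM.natDegree_mul hg.1, hg.2]; omega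
    · have : a %ₘ M + M * g - a = M * g - (a - a %ₘ M) := by ring
      rw [this]
      exact dvd_sub (dvd_mul_right _ _) hdvd
  · intro f hf
    simp only [Finset.coe_filter, Set.mem_ofPred_eq] at hf
    obtain ⟨hf, hfd⟩ := hf
    have hf := mem_monicFinset.1 hf
    have hd : M ∣ f - a %ₘ M := by
      have : f - a %ₘ M = (f - a) + (a - a %ₘ M) := by ring
      rw [this]; exact dvd_add hfd hdvd
    obtain ⟨g, hg⟩ := hd
    have hfg : f = a %ₘ M + M * g := by rw [← hg]; ring
    have hfdeg : (a %ₘ M).degree < f.degree := by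
      refine hlt.trans_le ?_
      rw [degree_eq_natDegree hM.ne_zero, degree_eq_natDegree hf.1.ne_zero, hf.2]
      exact_mod_cast hn
    have h1 : (f - a %ₘ M).Monic := hf.1.sub_of_left hfdeg
    have h2 : (f - a %ₘ M).natDegree = n := by
      rw [natDegree_eq_of_degree_eq (degree_sub_eq_left_of_degree_lt hfdeg), hf.2]
    have hgm : g.Monic := hM.of_mul_monic_left (by rw [← hg]; exact h1)
    show (f - a %ₘ M) /ₘ M ∈ monicFinset K (n - M.natDegree)
    rw [hg, mul_divByMonic_cancel_left g hM]
    refine mem_monicFinset.2 ⟨hgm, ?_⟩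
    rw [hg, hM.natDegree_mul hgm] at h2
    omega
  · intro g hg
    simp only [add_sub_cancel_left]
    exact mul_divByMonic_cancel_left g hM
  · intro f hf
    simp only [Finset.coe_filter, Set.mem_ofPred_eq] at hf
    have hd : M ∣ f - a %ₘ M := by
      have : f - a %ₘ M = (f - a) + (a - a %ₘ M) := by ring
      rw [this]; exact dvd_add hf.2 hdvd
    obtain ⟨g, hg⟩ := hd
    simp only
    rw [hg, mul_divByMonic_cancel_left g hM, ← hg]; ring

theorem IsPrimePoly.isCoprime {p p' : K[X]} (hp : IsPrimePoly p) (hp' : IsPrimePoly p')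
    (h : p ≠ p') : IsCoprime p p' := by
  rw [hp.2.coprime_iff_not_dvd]
  intro hd
  exact h (eq_of_monic_of_associated hp.1 hp'.1
    ((hp.2.dvd_irreducible_iff_associated hp'.2).1 hd))

theorem IsPrimePoly.natDegree_pos {p : K[X]} (hp : IsPrimePoly p) : 0 < p.natDegree :=
  hp.2.natDegree_pos

theorem setProd_monic {D : Finset K[X]} (hD : ∀ p ∈ D, IsPrimePoly p) : (setProd D).Monic :=
  monic_prod_of_monic _ _ fun p hp => (hD p hp).1

theorem natDegree_setProd {D : Finset K[X]} (hD : ∀ p ∈ D, IsPrimePoly p) :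
    (setProd D).natDegree = setDeg natDegree D :=
  natDegree_prod_of_monic _ _ fun p hp => (hD p hp).1

theorem setNorm_polyNorm (D : Finset K[X]) :
    setNorm polyNorm D = (Fintype.card K : ℝ) ^ setDeg natDegree D := by
  unfold setNorm setDeg polyNorm
  rw [Finset.prod_pow_eq_pow_sum]

theorem setProd_dvd_iff {D : Finset K[X]} (hD : ∀ p ∈ D, IsPrimePoly p) {f : K[X]} :
    setProd D ∣ f ↔ ∀ p ∈ D, p ∣ f := by
  refine ⟨fun h p hp => (Finset.dvd_prod_of_mem _ hp).trans h, fun h => ?_⟩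
  exact Finset.prod_dvd_of_coprime (fun p hp p' hp' hne => (hD p hp).isCoprime (hD p' hp') hne) h

theorem dvd_setProd_iff {D : Finset K[X]} (hD : ∀ p ∈ D, IsPrimePoly p) {p : K[X]}
    (hp : IsPrimePoly p) : p ∣ setProd D ↔ p ∈ D := by
  refine ⟨fun h => ?_, fun h => Finset.dvd_prod_of_mem _ h⟩
  obtain ⟨p', hp', hd⟩ := hp.2.prime.exists_mem_finset_dvd h
  have := eq_of_monic_of_associated hp.1 (hD p' hp').1
    ((hp.2.dvd_irreducible_iff_associated (hD p' hp').2).1 hd)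
  exact this ▸ hp'

theorem setProd_injOn {P : Finset K[X]} (hP : ∀ p ∈ P, IsPrimePoly p) :
    Set.InjOn setProd (P.powerset : Set (Finset K[X])) := by
  intro D hD E hE h
  have hD := Finset.mem_powerset.1 hD
  have hE := Finset.mem_powerset.1 hE
  ext p
  constructor
  · intro hp
    rw [← dvd_setProd_iff (fun q hq => hP q (hE hq)) (hP p (hD hp)), ← h]
    exact Finset.dvd_prod_of_mem _ hp
  · intro hp
    rw [← dvd_setProd_iff (fun q hq => hP q (hD hq)) (hP p (hE hp)), h]
    exact Finset.dvd_prod_of_mem _ hp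

theorem exists_prime_dvd {f : K[X]} (hf : 0 < f.natDegree) :
    ∃ p, IsPrimePoly p ∧ p ∣ f ∧ p.natDegree ≤ f.natDegree := by
  have hf0 : f ≠ 0 := by rintro rfl; simp at hf
  obtain ⟨p, hp, hpf⟩ := exists_monic_irreducible_factor f (not_isUnit_of_natDegree_pos f hf)
  exact ⟨p, ⟨hp, hpf.1⟩, hpf.2, natDegree_le_of_dvd hpf.2 hf0⟩

end Counting

section Primes

set_option linter.unusedSectionVars false

open scoped Classical

variable {K : Type*} [Field K] [Fintype K]

theorem isPrimePoly_of_mem {w : ℕ} {D : Finset K[X]} (hD : D ⊆ primesBelow K w) :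
    ∀ p ∈ D, IsPrimePoly p := fun _ hp => (mem_primesBelow.1 (hD hp)).1

theorem card_pos_real : (0 : ℝ) < Fintype.card K := by
  have := two_le_card (K := K); linarith

theorem two_le_polyNorm {p : K[X]} (hp : IsPrimePoly p) : 2 ≤ polyNorm p := by
  have h2 := two_le_card (K := K)
  exact h2.trans (le_self_pow₀ (by linarith) hp.natDegree_pos.ne')

theorem mertensSum_primesBelow {n L : ℕ} (hL : L ≤ n) :
    mertensSum polyNorm natDegree (primesBelow K (n + 1)) L = if L = 0 then 1 else 0 := by
  set P := primesBelow K (n + 1) with hP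
  have hq := card_pos_real (K := K)
  have h1 : mertensSum polyNorm natDegree P L = (∑ D ∈ P.powerset, ∑ f ∈ monicFinset K L,
      if setProd D ∣ f then (-1 : ℝ) ^ D.card else 0) / (Fintype.card K : ℝ) ^ L := by
    unfold mertensSum
    rw [Finset.sum_div]
    refine Finset.sum_congr rfl fun D hD => ?_
    have hDp := isPrimePoly_of_mem (Finset.mem_powerset.1 hD)
    rw [← Finset.sum_filter, Finset.sum_const, nsmul_eq_mul]
    split_ifs with h
    · have hc := card_monicFinset_filter (setProd_monic hDp) (n := L)
        (by rwa [natDegree_setProd hDp]) 0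
      simp only [sub_zero] at hc
      rw [hc, setNorm_polyNorm, natDegree_setProd hDp]
      push_cast
      rw [div_eq_div_iff (by positivity) (by positivity)]
      have : (Fintype.card K : ℝ) ^ L = (Fintype.card K : ℝ) ^ (L - setDeg natDegree D) *
          (Fintype.card K : ℝ) ^ setDeg natDegree D := by
        rw [← pow_add]; congr 1; omega
      rw [this]; ring
    · have : (monicFinset K L).filter (fun f => setProd D ∣ f) = ∅ := by
        refine Finset.filter_eq_empty_iff.2 fun f hf hd => h ?_
        have hf := mem_monicFinset.1 hf
        rw [← natDegree_setProd hDp, ← hf.2]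
        exact natDegree_le_of_dvd hd hf.1.ne_zero
      rw [this]; simp
  have h2 : ∀ f ∈ monicFinset K L, (∑ D ∈ P.powerset,
      if setProd D ∣ f then (-1 : ℝ) ^ D.card else 0) = if L = 0 then 1 else 0 := by
    intro f hf
    have hf := mem_monicFinset.1 hf
    have hfil : P.powerset.filter (fun D => setProd D ∣ f) =
        (P.filter (fun p => p ∣ f)).powerset := by
      ext D
      simp only [Finset.mem_filter, Finset.mem_powerset]
      constructor
      · rintro ⟨h1, h2⟩ p hp
        exact Finset.mem_filter.2 ⟨h1 hp, (setProd_dvd_iff (isPrimePoly_of_mem h1)).1 h2 p hp⟩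
      · intro h
        have h1 : D ⊆ P := h.trans (Finset.filter_subset _ _)
        exact ⟨h1, (setProd_dvd_iff (isPrimePoly_of_mem h1)).2 fun p hp =>
          (Finset.mem_filter.1 (h hp)).2⟩
    rw [← Finset.sum_filter, hfil]
    have := congrArg (Int.cast : ℤ → ℝ)
      (Finset.sum_powerset_neg_one_pow_card (x := P.filter (fun p => p ∣ f)))
    push_cast at this
    rw [this]
    congr 1
    rw [eq_iff_iff, Finset.filter_eq_empty_iff]
    constructor
    · intro h
      by_contra hL0
      obtain ⟨p, hp, hpf, hpd⟩ := exists_prime_dvd (f := f) (by omega)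
      exact h (mem_primesBelow.2 ⟨hp, by omega⟩) hpf
    · intro hL0 p hp hpf
      have := natDegree_le_of_dvd hpf hf.1.ne_zero
      have := (mem_primesBelow.1 hp).1.natDegree_pos
      omega
  rw [h1, Finset.sum_comm, Finset.sum_congr rfl h2, Finset.sum_const, card_monicFinset]
  split_ifs with h
  · subst h; simp
  · simp

theorem count_primesBelow (n L : ℕ) :
    ∑ D ∈ (primesBelow K (n + 1)).powerset,
      (if setDeg natDegree D ≤ L then 1 / setNorm polyNorm D else 0) ≤ L + 1 := by
  set P := primesBelow K (n + 1) with hP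
  have hq := card_pos_real (K := K)
  rw [← Finset.sum_filter]
  calc _ = ∑ D ∈ P.powerset.filter (fun D => setDeg natDegree D ≤ L), 1 / polyNorm (setProd D) := by
        refine Finset.sum_congr rfl fun D hD => ?_
        have hD := Finset.mem_powerset.1 (Finset.mem_filter.1 hD).1
        rw [setNorm_polyNorm, polyNorm, natDegree_setProd (isPrimePoly_of_mem hD)]
    _ = ∑ f ∈ (P.powerset.filter (fun D => setDeg natDegree D ≤ L)).image setProd,
          1 / polyNorm f := by
        rw [Finset.sum_image]
        exact (setProd_injOn (isPrimePoly_of_mem subset_rfl)).mono (by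
          intro D hD; exact Finset.filter_subset _ _ hD)
    _ ≤ ∑ f ∈ (Finset.range (L + 1)).biUnion (monicFinset K), 1 / polyNorm f := by
        refine Finset.sum_le_sum_of_subset_of_nonneg ?_ fun f _ _ => by
          unfold polyNorm; positivity
        intro f hf
        obtain ⟨D, hD, rfl⟩ := Finset.mem_image.1 hf
        obtain ⟨hD, hDL⟩ := Finset.mem_filter.1 hD
        have hDp := isPrimePoly_of_mem (Finset.mem_powerset.1 hD)
        refine Finset.mem_biUnion.2 ⟨setDeg natDegree D, by simp; omega, ?_⟩
        exact mem_monicFinset.2 ⟨setProd_monic hDp, natDegree_setProd hDp⟩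
    _ = ∑ m ∈ Finset.range (L + 1), ∑ f ∈ monicFinset K m, 1 / polyNorm f := by
        refine Finset.sum_biUnion fun i _ j _ hij => Finset.disjoint_left.2 fun f hi hj => hij ?_
        rw [← (mem_monicFinset.1 hi).2, (mem_monicFinset.1 hj).2]
    _ = ∑ m ∈ Finset.range (L + 1), (1 : ℝ) := by
        refine Finset.sum_congr rfl fun m _ => ?_
        rw [Finset.sum_congr rfl (g := fun _ => 1 / (Fintype.card K : ℝ) ^ m) fun f hf => by
          rw [polyNorm, (mem_monicFinset.1 hf).2], Finset.sum_const, card_monicFinset]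
        simp
    _ = _ := by simp

/-- There are at most `q ^ m / m` primes of degree `m`. -/
theorem mul_card_primes_le {m : ℕ} (hm : 1 ≤ m) (D : Finset K[X])
    (hD : ∀ p ∈ D, IsPrimePoly p ∧ p.natDegree = m) : D.card * m ≤ Fintype.card K ^ m := by
  have hDp : ∀ p ∈ D, IsPrimePoly p := fun p hp => (hD p hp).1
  have h1 : setProd D ∣ X ^ (Nat.card K) ^ m - X := by
    rw [setProd_dvd_iff hDp]
    intro p hp
    exact (hDp p hp).2.natDegree_dvd_iff_dvd_X_pow_card_pow_sub_X.1 (by rw [(hD p hp).2])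
  have hc : 1 < Nat.card K := Finite.one_lt_card
  have hne := FiniteField.X_pow_card_pow_sub_X_ne_zero K (n := m) (by omega) hc
  have h2 := natDegree_le_of_dvd h1 hne
  rw [FiniteField.X_pow_card_pow_sub_X_natDegree_eq K (by omega) hc, natDegree_setProd hDp,
    setDeg, Finset.sum_congr rfl fun _ hp => (hD _ hp).2, Finset.sum_const, smul_eq_mul,
    Nat.card_eq_fintype_card] at h2
  exact h2

theorem sum_primesBelow_eq {w : ℕ} {M : Type*} [AddCommMonoid M] (g : K[X] → M) :
    ∑ p ∈ primesBelow K w, g p =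
      ∑ m ∈ Finset.Ico 1 w, ∑ p ∈ (primesBelow K w).filter (fun p => p.natDegree = m), g p := by
  rw [Finset.sum_fiberwise_of_maps_to]
  intro p hp
  have := mem_primesBelow.1 hp
  exact Finset.mem_Ico.2 ⟨this.1.natDegree_pos, this.2⟩

theorem mul_card_primesBelow_filter_le {m : ℕ} (hm : 1 ≤ m) (w : ℕ) :
    ((primesBelow K w).filter (fun p => p.natDegree = m)).card * m ≤ Fintype.card K ^ m :=
  mul_card_primes_le hm _ fun _ hp =>
    ⟨(mem_primesBelow.1 (Finset.mem_filter.1 hp).1).1, (Finset.mem_filter.1 hp).2⟩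

theorem setDeg_primesBelow_le (w : ℕ) :
    setDeg natDegree (primesBelow K w) ≤ w * Fintype.card K ^ w := by
  unfold setDeg
  rw [sum_primesBelow_eq]
  calc _ ≤ ∑ m ∈ Finset.Ico 1 w, Fintype.card K ^ w := by
        refine Finset.sum_le_sum fun m hm => ?_
        rw [Finset.mem_Ico] at hm
        rw [Finset.sum_congr rfl fun p hp => (Finset.mem_filter.1 hp).2, Finset.sum_const,
          smul_eq_mul]
        exact (mul_card_primesBelow_filter_le hm.1 w).trans
          (Nat.pow_le_pow_right Fintype.card_pos hm.2.le)
    _ ≤ _ := by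
        rw [Finset.sum_const, smul_eq_mul, Nat.card_Ico]
        exact Nat.mul_le_mul_right _ (by omega)

theorem sum_sq_primesBelow_le (w : ℕ) : ∑ p ∈ primesBelow K w, 1 / polyNorm p ^ 2 ≤ 1 := by
  rw [sum_primesBelow_eq]
  have hq := two_le_card (K := K)
  calc _ ≤ ∑ m ∈ Finset.Ico 1 w, (1 / 2 : ℝ) ^ m := by
        refine Finset.sum_le_sum fun m hm => ?_
        rw [Finset.mem_Ico] at hm
        rw [Finset.sum_congr rfl (g := fun _ => 1 / ((Fintype.card K : ℝ) ^ m) ^ 2) fun p hp => by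
          rw [polyNorm, (Finset.mem_filter.1 hp).2], Finset.sum_const, nsmul_eq_mul]
        have h1 := mul_card_primesBelow_filter_le (K := K) hm.1 w
        have h2 : (((primesBelow K w).filter (fun p => p.natDegree = m)).card : ℝ) ≤
            (Fintype.card K : ℝ) ^ m := by
          exact_mod_cast (Nat.le_mul_of_pos_right _ hm.1).trans h1
        calc _ ≤ (Fintype.card K : ℝ) ^ m * (1 / ((Fintype.card K : ℝ) ^ m) ^ 2) := by gcongr
          _ = (1 / (Fintype.card K : ℝ)) ^ m := by
            have : (Fintype.card K : ℝ) ^ m ≠ 0 := by positivity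
            rw [div_pow, one_pow]; field_simp
          _ ≤ (1 / 2 : ℝ) ^ m := by gcongr
    _ ≤ 1 := by
        rcases Nat.lt_or_ge w 1 with h | h
        · have : w = 0 := by omega
          subst this; simp
        · rw [geom_sum_Ico (by norm_num) h]
          have : (0 : ℝ) < (1 / 2) ^ w := by positivity
          rw [div_le_iff_of_neg (by norm_num)]
          norm_num at *

theorem primeSystem_primesBelow (n : ℕ) :
    PrimeSystem polyNorm natDegree (primesBelow K (n + 1)) n where
  two_le _ hp := two_le_polyNorm (mem_primesBelow.1 hp).1
  deg_pos _ hp := (mem_primesBelow.1 hp).1.natDegree_pos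
  mertens _ hL := mertensSum_primesBelow hL
  count L := count_primesBelow n L
  sum_sq := sum_sq_primesBelow_le _

theorem primorial_eq (w : ℕ) : primorial K w = setProd (primesBelow K w) := by
  unfold primorial setProd primesBelow
  rw [finprod_mem_eq_finite_toFinset_prod _ (finite_primes K w)]

theorem totient_setProd {D : Finset K[X]} (hD : ∀ p ∈ D, IsPrimePoly p) :
    (totient (setProd D) : ℝ) = setTotient polyNorm D := by
  unfold totient setTotient
  have hco : ∀ i j : D, i ≠ j → IsCoprime i.1 j.1 := fun i j hij =>
    (hD i i.2).isCoprime (hD j j.2) fun h => hij (Subtype.ext h)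
  have hI : Pairwise (Function.onFun IsCoprime fun i : D => Ideal.span {i.1}) := fun i j hij =>
    (Ideal.isCoprime_span_singleton_iff _ _).2 (hco i j hij)
  have e1 : Ideal.span {setProd D} = ⨅ i : D, Ideal.span {i.1} := by
    rw [Ideal.iInf_span_singleton hco]
    congr 2
    exact (Finset.prod_coe_sort D (fun p => p)).symm
  rw [e1, Nat.card_congr (Units.mapEquiv
    (Ideal.quotientInfRingEquivPiQuotient _ hI).toMulEquiv).toEquiv,
    Nat.card_congr MulEquiv.piUnits.toEquiv, Nat.card_pi]
  push_cast
  rw [← Finset.prod_coe_sort D (fun p => polyNorm p - 1)]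
  refine Finset.prod_congr rfl fun p _ => ?_
  have hp := hD p.1 p.2
  have : Fact (Irreducible p.1) := ⟨hp.2⟩
  have hmax : (Ideal.span {p.1}).IsMaximal := PrincipalIdealRing.isMaximal_of_irreducible hp.2
  let := Ideal.Quotient.field (Ideal.span {p.1})
  have hfr : Module.finrank K (K[X] ⧸ Ideal.span {p.1}) = p.1.natDegree :=
    finrank_quotient_span_eq_natDegree (f := p.1)
  have : Module.Finite K (K[X] ⧸ Ideal.span {p.1}) :=
    Module.finite_of_finrank_pos (by rw [hfr]; exact hp.natDegree_pos)
  have : Finite (K[X] ⧸ Ideal.span {p.1}) := Module.finite_of_finite K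
  let := Fintype.ofFinite (K[X] ⧸ Ideal.span {p.1})
  have hcard : Fintype.card (K[X] ⧸ Ideal.span {p.1}) = Fintype.card K ^ p.1.natDegree := by
    rw [Module.card_eq_pow_finrank (K := K), hfr]
  rw [Nat.card_eq_fintype_card, Fintype.card_units, hcard, Nat.cast_sub, polyNorm]
  · simp
  · exact Nat.one_le_pow _ _ Fintype.card_pos

theorem eulerFactor_primesBelow (w : ℕ) :
    eulerFactor polyNorm (primesBelow K w) =
      polyNorm (primorial K w) / (totient (primorial K w) : ℝ) := by
  have h := isPrimePoly_of_mem (subset_refl (primesBelow K w))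
  rw [eulerFactor_eq_div fun p hp => two_le_polyNorm (h p hp), primorial_eq, totient_setProd h,
    setNorm_polyNorm, polyNorm, natDegree_setProd h]

end Primes

section Differences

variable {k : ℕ}

/-- Iterated differences with step `δ` in the coordinate directions listed in `L`. -/
def diffList (δ : ℝ) : List (Fin k) → ((Fin k → ℝ) → ℝ) → (Fin k → ℝ) → ℝ
  | [], F => F
  | j :: L, F => fun t => diffList δ L F t - diffList δ L F (t + δ • Pi.single j 1)

/-- The partial derivative in the direction `j` within the orthant. -/
def partialDeriv (j : Fin k) (F : (Fin k → ℝ) → ℝ) (t : Fin k → ℝ) : ℝ :=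
  fderivWithin ℝ F (orthant k) t (Pi.single j 1)

theorem orthant_eq_pi : orthant k = Set.univ.pi fun _ => Set.Ici 0 := by
  ext t; simp [orthant, Pi.le_def]

theorem uniqueDiffOn_orthant : UniqueDiffOn ℝ (orthant k) := by
  rw [orthant_eq_pi]
  exact UniqueDiffOn.univ_pi fun _ => uniqueDiffOn_Ici 0

theorem add_smul_single_mem_orthant {t : Fin k → ℝ} (ht : t ∈ orthant k) {u : ℝ} (hu : 0 ≤ u)
    (j : Fin k) : t + u • (Pi.single j 1 : Fin k → ℝ) ∈ orthant k := by
  intro i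
  have := ht i
  by_cases h : i = j
  · subst h; simp; linarith
  · simp [h, this]

theorem isCompact_simplex : IsCompact (simplex k) := by
  have h1 : simplex k = (Set.univ.pi fun _ => Set.Icc (0 : ℝ) 1) ∩ {t | ∑ j, t j ≤ 1} := by
    ext t; simp only [simplex, Set.mem_inter_iff, Set.mem_univ_pi, Set.mem_ofPred_eq]
  rw [h1]
  exact (isCompact_univ_pi fun _ => isCompact_Icc).inter_right
    (isClosed_le (by fun_prop) continuous_const)

theorem simplex_subset_orthant : simplex k ⊆ orthant k := fun _ ht j => (ht.1 j).1

theorem contDiffOn_partialDeriv {F : (Fin k → ℝ) → ℝ} (hF : ContDiffOn ℝ ∞ F (orthant k))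
    (j : Fin k) : ContDiffOn ℝ ∞ (partialDeriv j F) (orthant k) :=
  (hF.fderivWithin uniqueDiffOn_orthant (by simp)).clm_apply contDiffOn_const

theorem partialDeriv_eq_zero {F : (Fin k → ℝ) → ℝ}
    (hs : ∀ t ∈ orthant k, t ∉ simplex k → F t = 0) (j : Fin k) :
    ∀ t ∈ orthant k, t ∉ simplex k → partialDeriv j F t = 0 := by
  intro t ht hts
  have hev : F =ᶠ[nhdsWithin t (orthant k)] fun _ => 0 := by
    have h1 : (simplex k)ᶜ ∈ nhds t := isCompact_simplex.isClosed.isOpen_compl.mem_nhds hts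
    filter_upwards [self_mem_nhdsWithin, mem_nhdsWithin_of_mem_nhds h1] with x hx hx'
    exact hs x hx hx'
  unfold partialDeriv
  rw [hev.fderivWithin_eq (hs t ht hts)]
  simp

theorem hasDerivWithinAt_diffList {F : (Fin k → ℝ) → ℝ} (hF : ContDiffOn ℝ ∞ F (orthant k))
    {δ : ℝ} (hδ : 0 ≤ δ) (j : Fin k) (L : List (Fin k)) :
    ∀ t ∈ orthant k, ∀ u ∈ Set.Ici (0 : ℝ),
      HasDerivWithinAt (fun u : ℝ => diffList δ L F (t + u • Pi.single j 1))
        (diffList δ L (partialDeriv j F) (t + u • Pi.single j 1)) (Set.Ici 0) u := by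
  induction L with
  | nil =>
    intro t ht u hu
    have h1 : DifferentiableWithinAt ℝ F (orthant k) (t + u • Pi.single j 1) :=
      (hF.differentiableOn (by simp)) _ (add_smul_single_mem_orthant ht hu j)
    have h2 : HasDerivWithinAt (fun u : ℝ => t + u • (Pi.single j 1 : Fin k → ℝ))
        (Pi.single j 1) (Set.Ici 0) u := by
      have := ((hasDerivAt_id u).smul_const (Pi.single j 1 : Fin k → ℝ)).const_add t
      simpa using this.hasDerivWithinAt
    exact h1.hasFDerivWithinAt.comp_hasDerivWithinAt u h2
      fun v hv => add_smul_single_mem_orthant ht hv j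
  | cons i L ih =>
    intro t ht u hu
    have h1 := ih t ht u hu
    have h2 := ih _ (add_smul_single_mem_orthant ht hδ i) u hu
    have e : ∀ v : ℝ, t + δ • (Pi.single i 1 : Fin k → ℝ) + v • Pi.single j 1 =
        t + v • Pi.single j 1 + δ • Pi.single i 1 := fun v => add_right_comm _ _ _
    simp only [e] at h2
    exact h1.sub h2

/-- Iterated differences of a smooth function supported on the simplex are bounded by the
corresponding power of the step. -/
theorem exists_abs_diffList_le (L : List (Fin k)) :
    ∀ F : (Fin k → ℝ) → ℝ, ContDiffOn ℝ ∞ F (orthant k) →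
      (∀ t ∈ orthant k, t ∉ simplex k → F t = 0) →
      ∃ C : ℝ, 0 ≤ C ∧ ∀ δ : ℝ, 0 ≤ δ → ∀ t ∈ orthant k,
        |diffList δ L F t| ≤ C * δ ^ L.length := by
  induction L with
  | nil =>
    intro F hF hs
    obtain ⟨C, hC⟩ := isCompact_simplex.exists_bound_of_continuousOn
      (hF.continuousOn.mono simplex_subset_orthant)
    refine ⟨max C 0, le_max_right _ _, fun δ _ t ht => ?_⟩
    simp only [diffList, List.length_nil, pow_zero, mul_one]
    by_cases h : t ∈ simplex k
    · exact (hC t h).trans (le_max_left _ _)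
    · rw [hs t ht h, abs_zero]; exact le_max_right _ _
  | cons j L ih =>
    intro F hF hs
    obtain ⟨C, hC0, hC⟩ := ih (partialDeriv j F) (contDiffOn_partialDeriv hF j)
      (partialDeriv_eq_zero hs j)
    refine ⟨C, hC0, fun δ hδ t ht => ?_⟩
    have := (convex_Ici (0 : ℝ)).norm_image_sub_le_of_norm_hasDerivWithin_le
      (f := fun u : ℝ => diffList δ L F (t + u • Pi.single j 1))
      (fun u hu => hasDerivWithinAt_diffList hF hδ j L t ht u hu)
      (fun u hu => hC δ hδ _ (add_smul_single_mem_orthant ht hu j))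
      (Set.mem_Ici.2 hδ) (Set.mem_Ici.2 le_rfl)
    simp only [zero_smul, add_zero, zero_sub, norm_neg, Real.norm_eq_abs, abs_of_nonneg hδ] at this
    rw [List.length_cons, pow_succ, ← mul_assoc]
    exact this

theorem diffList_eq_zero {F : (Fin k → ℝ) → ℝ} (hs : ∀ t ∈ orthant k, t ∉ simplex k → F t = 0)
    {δ : ℝ} (hδ : 0 ≤ δ) (L : List (Fin k)) :
    ∀ t ∈ orthant k, 1 < ∑ j, t j → diffList δ L F t = 0 := by
  induction L with
  | nil => intro t ht h1; exact hs t ht fun h => by linarith [h.2]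
  | cons i L ih =>
    intro t ht h1
    have h2 : 1 < ∑ j, (t + δ • (Pi.single i 1 : Fin k → ℝ)) j := by
      simp only [Pi.add_apply, Pi.smul_apply, smul_eq_mul, Finset.sum_add_distrib,
        ← Finset.mul_sum]
      simp; linarith
    simp only [diffList]
    rw [ih t ht h1, ih _ (add_smul_single_mem_orthant ht hδ i) h2, sub_zero]

/-- Iterated forward differences on the lattice. -/
def latticeDiff : List (Fin k) → ((Fin k → ℕ) → ℝ) → (Fin k → ℕ) → ℝ
  | [], G => G
  | j :: L, G => fun x => latticeDiff L G x - latticeDiff L G (Function.update x j (x j + 1))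

theorem latticeDiff_eq_diffList (F : (Fin k → ℝ) → ℝ) (r : ℝ) (L : List (Fin k)) :
    ∀ x : Fin k → ℕ, latticeDiff L (fun x => F fun j => (x j : ℝ) / r) x =
      diffList (1 / r) L F fun j => (x j : ℝ) / r := by
  induction L with
  | nil => intro x; rfl
  | cons i L ih =>
    intro x
    simp only [latticeDiff, diffList]
    rw [ih, ih]
    congr 2
    ext j
    by_cases h : j = i
    · subst h; simp; ring
    · simp [h]

/-- Partial sums. -/
def cumSum (m : ℕ → ℝ) (x : ℕ) : ℝ := ∑ y ∈ Finset.range (x + 1), m y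

theorem cumSum_sub (m : ℕ → ℝ) (x : ℕ) :
    cumSum m x - (if x = 0 then 0 else cumSum m (x - 1)) = m x := by
  unfold cumSum
  cases x with
  | zero => simp
  | succ x => simp [Finset.sum_range_succ]

/-- Summation by parts in one of `k` variables. -/
theorem sum_mul_prod_eq {M : ℕ} (G : (Fin k → ℕ) → ℝ) (i : Fin k)
    (hG : ∀ x, M ≤ x i → G x = 0) (m : Fin k → ℕ → ℝ) :
    ∑ x ∈ Fintype.piFinset (fun _ : Fin k => Finset.range M), G x * ∏ j, m j (x j) =
    ∑ x ∈ Fintype.piFinset (fun _ : Fin k => Finset.range M),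
      (G x - G (Function.update x i (x i + 1))) *
        ∏ j, Function.update m i (cumSum (m i)) j (x j) := by
  set box := Fintype.piFinset (fun _ : Fin k => Finset.range M) with hbox
  have hprod : ∀ (m' : ℕ → ℝ) (x : Fin k → ℕ), ∏ j, Function.update m i m' j (x j) =
      m' (x i) * ∏ j ∈ Finset.univ.erase i, m j (x j) := by
    intro m' x
    rw [← Finset.mul_prod_erase Finset.univ _ (Finset.mem_univ i), Function.update_self]
    congr 1
    refine Finset.prod_congr rfl fun j hj => ?_
    rw [Function.update_of_ne (Finset.ne_of_mem_erase hj)]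
  have hprod' : ∀ x : Fin k → ℕ, ∏ j, m j (x j) =
      m i (x i) * ∏ j ∈ Finset.univ.erase i, m j (x j) := fun x =>
    (Finset.mul_prod_erase Finset.univ _ (Finset.mem_univ i)).symm
  set A : (Fin k → ℕ) → ℝ := fun x => ∏ j ∈ Finset.univ.erase i, m j (x j) with hA
  have hAu : ∀ x y, A (Function.update x i y) = A x := by
    intro x y
    refine Finset.prod_congr rfl fun j hj => ?_
    rw [Function.update_of_ne (Finset.ne_of_mem_erase hj)]
  have hmem : ∀ x, x ∈ box ↔ ∀ j, x j < M := by intro x; simp [hbox]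
  have hshift : ∑ x ∈ box, G (Function.update x i (x i + 1)) * (cumSum (m i) (x i) * A x) =
      ∑ x ∈ box, if x i = 0 then 0 else G x * (cumSum (m i) (x i - 1) * A x) := by
    have h1 : ∑ x ∈ box, G (Function.update x i (x i + 1)) * (cumSum (m i) (x i) * A x) =
        ∑ x ∈ box.filter (fun x => x i + 1 < M),
          G (Function.update x i (x i + 1)) * (cumSum (m i) (x i) * A x) := by
      rw [Finset.sum_filter]
      refine Finset.sum_congr rfl fun x _ => ?_
      split_ifs with h
      · rfl
      · rw [hG _ (by rw [Function.update_self]; omega), zero_mul]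
    have h2 : (∑ x ∈ box, if x i = 0 then 0 else G x * (cumSum (m i) (x i - 1) * A x)) =
        ∑ x ∈ box.filter (fun x => x i ≠ 0), G x * (cumSum (m i) (x i - 1) * A x) := by
      rw [Finset.sum_filter]
      exact Finset.sum_congr rfl fun x _ => by split_ifs <;> simp_all
    rw [h1, h2]
    refine Finset.sum_nbij' (fun x => Function.update x i (x i + 1))
      (fun x => Function.update x i (x i - 1)) ?_ ?_ ?_ ?_ ?_
    · intro x hx
      simp only [Finset.mem_filter, hmem] at hx ⊢
      refine ⟨fun j => ?_, by simp⟩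
      by_cases h : j = i
      · subst h; simpa using hx.2
      · simpa [h] using hx.1 j
    · intro x hx
      simp only [Finset.mem_filter, hmem] at hx ⊢
      refine ⟨fun j => ?_, ?_⟩
      · by_cases h : j = i
        · subst h; simp only [Function.update_self]; have := hx.1 j; omega
        · simpa [h] using hx.1 j
      · simp only [Function.update_self]; have := hx.1 i; omega
    · intro x _; simp
    · intro x hx
      have h0 := (Finset.mem_filter.1 hx).2
      simp only [Function.update_self, Function.update_idem]
      rw [Nat.sub_add_cancel (by omega), Function.update_eq_self]
    · intro x _
      simp [hAu]
  simp only [hprod, hprod', sub_mul, Finset.sum_sub_distrib]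
  rw [hshift, ← Finset.sum_sub_distrib]
  refine Finset.sum_congr rfl fun x _ => ?_
  conv_lhs => rw [← cumSum_sub (m i) (x i)]
  split_ifs <;> ring

theorem latticeDiff_eq_zero {M : ℕ} {G : (Fin k → ℕ) → ℝ} (hG : ∀ i x, M ≤ x i → G x = 0)
    (L : List (Fin k)) : ∀ i x, M ≤ x i → latticeDiff L G x = 0 := by
  induction L with
  | nil => exact hG
  | cons j L ih =>
    intro i x hx
    simp only [latticeDiff]
    rw [ih i x hx, ih i _ ?_, sub_zero]
    by_cases h : i = j
    · subst h; simp; omega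
    · simpa [h] using hx

theorem sum_mul_prod_eq_latticeDiff {M : ℕ} {G : (Fin k → ℕ) → ℝ}
    (hG : ∀ i x, M ≤ x i → G x = 0) (m : Fin k → ℕ → ℝ) (L : List (Fin k)) :
    ∑ x ∈ Fintype.piFinset (fun _ : Fin k => Finset.range M), G x * ∏ j, m j (x j) =
    ∑ x ∈ Fintype.piFinset (fun _ : Fin k => Finset.range M),
      latticeDiff L G x * ∏ j, (cumSum^[L.count j] (m j)) (x j) := by
  induction L with
  | nil => simp [latticeDiff]
  | cons i L ih =>
    rw [ih, sum_mul_prod_eq _ i (fun x hx => latticeDiff_eq_zero hG L i x hx)]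
    refine Finset.sum_congr rfl fun x _ => ?_
    congr 1
    refine Finset.prod_congr rfl fun j _ => ?_
    by_cases h : j = i
    · subst h
      rw [Function.update_self, List.count_cons_self, Function.iterate_succ_apply']
    · rw [Function.update_of_ne h, List.count_cons_of_ne (fun h' => h h'.symm)]

end Differences

section Expansion

/-- The truncated quadratic weight `binom (l - x + 2) 2`, zero for `x > l`. -/
def quadWeight (l x : ℕ) : ℝ := ((l + 2 - x).choose 2 : ℕ)

theorem quadWeight_sub (l x : ℕ) : quadWeight l x - quadWeight l (x + 1) = (l + 1 - x : ℕ) := by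
  unfold quadWeight
  rcases Nat.lt_or_ge (l + 1) x with h | h
  · rw [show l + 2 - x = 0 by omega, show l + 2 - (x + 1) = 0 by omega, show l + 1 - x = 0 by omega]
    simp
  · obtain ⟨y, hy⟩ : ∃ y, l + 1 = x + y := ⟨l + 1 - x, by omega⟩
    rw [show l + 2 - x = y + 1 by omega, show l + 2 - (x + 1) = y by omega,
      Nat.choose_succ_succ' y 1]
    rw [show l + 1 - x = y by omega]
    simp

theorem quadWeight_eq_zero {l x : ℕ} (h : l < x) : quadWeight l x = 0 := by
  unfold quadWeight
  rw [Nat.choose_eq_zero_of_lt (by omega)]; simp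

theorem slopeBound_quadWeight {l : ℕ} {B : ℝ} (hB : (l : ℝ) + 1 ≤ B) :
    SlopeBound (quadWeight l) l B where
  anti x := by
    have := quadWeight_sub l x
    have h2 : (0 : ℝ) ≤ (l + 1 - x : ℕ) := Nat.cast_nonneg _
    linarith
  slope x := by
    rw [quadWeight_sub]
    have : ((l + 1 - x : ℕ) : ℝ) ≤ (l + 1 : ℕ) := by exact_mod_cast Nat.sub_le _ _
    push_cast at this; linarith
  supp _ hx := quadWeight_eq_zero hx

theorem slopeBound_quadWeight_sub (l m : ℕ) :
    SlopeBound (fun x => quadWeight l x - quadWeight l (x + m)) l m := by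
  have key : ∀ x, (quadWeight l x - quadWeight l (x + m)) -
      (quadWeight l (x + 1) - quadWeight l (x + 1 + m)) =
      ((l + 1 - x : ℕ) : ℝ) - (l + 1 - (x + m) : ℕ) := by
    intro x
    rw [← quadWeight_sub, ← quadWeight_sub, add_right_comm]; ring
  refine ⟨fun x => ?_, fun x => ?_, fun x hx => ?_⟩
  · have h : ((l + 1 - (x + m) : ℕ) : ℝ) ≤ (l + 1 - x : ℕ) := by
      exact_mod_cast (by omega)
    linarith [key x]
  · have h : ((l + 1 - x : ℕ) : ℝ) ≤ (l + 1 - (x + m) : ℕ) + m := by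
      exact_mod_cast (by omega)
    linarith [key x]
  · simp only [quadWeight_eq_zero hx, quadWeight_eq_zero (show l < x + m by omega), sub_zero]

theorem cumSum_iterate_three {X : Type*} (D : Finset X) (ν : X → ℝ) (deg : X → ℕ) (l : ℕ) :
    cumSum^[3] (fun x => ∑ d ∈ D, if deg d = x then ν d else 0) l =
      ∑ d ∈ D, ν d * quadWeight l (deg d) := by
  have h1 : cumSum (fun x => ∑ d ∈ D, if deg d = x then ν d else 0) =
      fun x => ∑ d ∈ D, if deg d ≤ x then ν d else 0 := by
    ext x
    unfold cumSum
    rw [Finset.sum_comm]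
    refine Finset.sum_congr rfl fun d _ => ?_
    rw [Finset.sum_ite_eq]
    simp
  have h2 : cumSum (fun x => ∑ d ∈ D, if deg d ≤ x then ν d else 0) =
      fun x => ∑ d ∈ D, ν d * (x + 1 - deg d : ℕ) := by
    ext x
    unfold cumSum
    rw [Finset.sum_comm]
    refine Finset.sum_congr rfl fun d _ => ?_
    induction x with
    | zero =>
      rw [Finset.sum_range_one]
      split_ifs with h
      · simp [Nat.le_zero.1 h]
      · rw [show 0 + 1 - deg d = 0 by omega]; simp
    | succ x ih =>
      rw [Finset.sum_range_succ, ih]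
      split_ifs with h
      · rw [show x + 1 + 1 - deg d = (x + 1 - deg d) + 1 by omega]; push_cast; ring
      · rw [show x + 1 + 1 - deg d = 0 by omega, show x + 1 - deg d = 0 by omega]; simp
  have h3 : cumSum (fun x => ∑ d ∈ D, ν d * (x + 1 - deg d : ℕ)) =
      fun x => ∑ d ∈ D, ν d * quadWeight x (deg d) := by
    ext x
    unfold cumSum
    rw [Finset.sum_comm]
    refine Finset.sum_congr rfl fun d _ => ?_
    rw [← Finset.mul_sum]
    congr 1
    have hq : ∀ x, quadWeight (x + 1) (deg d) - quadWeight x (deg d) = (x + 1 + 1 - deg d : ℕ) := by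
      intro x
      have := quadWeight_sub (x + 1) (deg d)
      have e : quadWeight (x + 1) (deg d + 1) = quadWeight x (deg d) := by
        unfold quadWeight; congr 2; omega
      rw [← e, this]
    induction x with
    | zero =>
      rw [Finset.sum_range_one]
      unfold quadWeight
      rcases Nat.lt_or_ge 0 (deg d) with h | h
      · rw [show 0 + 1 - deg d = 0 by omega, Nat.choose_eq_zero_of_lt (by omega)]
      · rw [Nat.le_zero.1 h]; simp
    | succ x ih => rw [Finset.sum_range_succ, ih, ← hq x]; ring
  simp only [Function.iterate_succ, Function.comp_apply, Function.iterate_zero, id]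
  rw [h1, h2, h3]

/-- The lattice points of the simplex `y_1 + ⋯ + y_k ≤ r`. -/
def latticeSimplex (k : ℕ) (r : ℝ) : Finset (Fin k → ℕ) :=
  (Fintype.piFinset (fun _ : Fin k => Finset.range (⌊r⌋₊ + 1))).filter
    (fun y => ((∑ j, y j : ℕ) : ℝ) ≤ r)

theorem mem_latticeSimplex {k : ℕ} {r : ℝ} {y : Fin k → ℕ} (hy : y ∈ latticeSimplex k r) :
    ((∑ j, y j : ℕ) : ℝ) ≤ r := (Finset.mem_filter.1 hy).2

theorem card_latticeSimplex_le {k : ℕ} {r : ℝ} (hr : 1 ≤ r) :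
    ((latticeSimplex k r).card : ℝ) ≤ (2 * r) ^ k := by
  have h1 : (latticeSimplex k r).card ≤ (⌊r⌋₊ + 1) ^ k := by
    refine (Finset.card_filter_le _ _).trans ?_
    rw [Fintype.card_piFinset]; simp
  have h2 : ((⌊r⌋₊ : ℝ) + 1) ≤ 2 * r := by
    have := Nat.floor_le (show (0 : ℝ) ≤ r by linarith)
    linarith
  calc ((latticeSimplex k r).card : ℝ) ≤ ((⌊r⌋₊ : ℝ) + 1) ^ k := by exact_mod_cast h1
    _ ≤ _ := by gcongr

/-- A sum weighted by a sieve function is bounded in mean square by sums weighted by truncated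
quadratic weights. -/
theorem IsSieveFunction.exists_sq_sum_le {k : ℕ} {F : (Fin k → ℝ) → ℝ} (hF : IsSieveFunction F) :
    ∃ C : ℝ, 0 < C ∧ ∀ r : ℝ, 1 ≤ r → ∀ {X : Type*} (D : Fin k → Finset X) (ν : X → ℝ)
      (deg : X → ℕ),
      (∑ d ∈ Fintype.piFinset D, (∏ j, ν (d j)) * F (fun j => (deg (d j) : ℝ) / r)) ^ 2 ≤
        C * r ^ k / (r ^ k) ^ 6 * ∑ y ∈ latticeSimplex k r,
          ∏ j, (∑ d ∈ D j, ν d * quadWeight (y j) (deg d)) ^ 2 := by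
  set L : List (Fin k) := List.finRange k ++ List.finRange k ++ List.finRange k with hL
  have hLlen : L.length = k * 3 := by simp [hL]; ring
  have hLcount : ∀ j, L.count j = 3 := by
    intro j
    have : (List.finRange k).count j = 1 :=
      List.count_eq_one_of_mem (List.nodup_finRange k) (List.mem_finRange j)
    simp [hL, List.count_append, this]
  obtain ⟨C, hC0, hC⟩ := exists_abs_diffList_le L F hF.smooth hF.supported
  refine ⟨C ^ 2 * 2 ^ k + 1, by positivity, fun r hr X D ν deg => ?_⟩
  have hr0 : 0 < r := by linarith
  set M := ⌊r⌋₊ + 1 with hM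
  set G : (Fin k → ℕ) → ℝ := fun x => F fun j => (x j : ℝ) / r with hG
  have horth : ∀ x : Fin k → ℕ, (fun j => (x j : ℝ) / r) ∈ orthant k := fun x j => by positivity
  have hGz : ∀ i x, M ≤ x i → G x = 0 := by
    intro i x hx
    refine hF.supported _ (horth x) fun h => ?_
    have h1 : (x i : ℝ) / r ≤ 1 := (h.1 i).2
    rw [div_le_one hr0] at h1
    have := Nat.lt_of_floor_lt (show ⌊r⌋₊ < x i by omega)
    linarith
  set m : Fin k → ℕ → ℝ := fun j x => ∑ d ∈ D j, if deg d = x then ν d else 0 with hm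
  set box := Fintype.piFinset (fun _ : Fin k => Finset.range M) with hbox
  have h1 : (∑ d ∈ Fintype.piFinset D, (∏ j, ν (d j)) * F (fun j => (deg (d j) : ℝ) / r)) =
      ∑ x ∈ box, G x * ∏ j, m j (x j) := by
    simp only [hm, Finset.prod_univ_sum, Finset.mul_sum]
    rw [Finset.sum_comm]
    refine Finset.sum_congr rfl fun d _ => ?_
    have hp : ∀ x : Fin k → ℕ, (∏ j, if deg (d j) = x j then ν (d j) else 0) =
        if (fun j => deg (d j)) = x then ∏ j, ν (d j) else 0 := by
      intro x
      split_ifs with h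
      · exact Finset.prod_congr rfl fun j _ => if_pos (congrFun h j)
      · obtain ⟨j, hj⟩ := Function.ne_iff.1 h
        exact Finset.prod_eq_zero (Finset.mem_univ j) (if_neg hj)
    simp only [hp, mul_ite, mul_zero]
    rw [Finset.sum_ite_eq]
    split_ifs with h
    · rw [mul_comm]
    · have : ∃ i, M ≤ deg (d i) := by
        by_contra hcon
        push Not at hcon
        exact h (Fintype.mem_piFinset.2 fun j => Finset.mem_range.2 (hcon j))
      obtain ⟨i, hi⟩ := this
      have := hGz i (fun j => deg (d j)) hi
      simp only [hG] at this
      rw [this, mul_zero]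
  have h2 := sum_mul_prod_eq_latticeDiff hGz m L
  have h3 : ∑ x ∈ box, latticeDiff L G x * ∏ j, (cumSum^[L.count j] (m j)) (x j) =
      ∑ y ∈ latticeSimplex k r, latticeDiff L G y *
        ∏ j, ∑ d ∈ D j, ν d * quadWeight (y j) (deg d) := by
    rw [latticeSimplex, Finset.sum_filter]
    refine Finset.sum_congr rfl fun x _ => ?_
    split_ifs with h
    · congr 1
      refine Finset.prod_congr rfl fun j _ => ?_
      rw [hLcount, hm, cumSum_iterate_three]
    · rw [hG, latticeDiff_eq_diffList, diffList_eq_zero hF.supported (by positivity) L _ (horth x),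
        zero_mul]
      rw [← Finset.sum_div, lt_div_iff₀ hr0, one_mul]
      push Not at h
      exact_mod_cast h
  rw [h1, h2, h3]
  have hD : ∀ y, |latticeDiff L G y| ≤ C * (1 / r) ^ (k * 3) := by
    intro y
    rw [hG, latticeDiff_eq_diffList, ← hLlen]
    exact hC (1 / r) (by positivity) _ (horth y)
  set T := ∑ y ∈ latticeSimplex k r, ∏ j, (∑ d ∈ D j, ν d * quadWeight (y j) (deg d)) ^ 2 with hT
  have hT0 : 0 ≤ T := Finset.sum_nonneg fun y _ => Finset.prod_nonneg fun j _ => sq_nonneg _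
  calc _ ≤ (∑ y ∈ latticeSimplex k r, latticeDiff L G y ^ 2) *
        ∑ y ∈ latticeSimplex k r, (∏ j, ∑ d ∈ D j, ν d * quadWeight (y j) (deg d)) ^ 2 :=
        Finset.sum_mul_sq_le_sq_mul_sq _ _ _
    _ = (∑ y ∈ latticeSimplex k r, latticeDiff L G y ^ 2) * T := by
        rw [hT]; simp only [Finset.prod_pow]
    _ ≤ ((2 * r) ^ k * (C * (1 / r) ^ (k * 3)) ^ 2) * T := by
        refine mul_le_mul_of_nonneg_right ?_ hT0
        calc _ ≤ ∑ y ∈ latticeSimplex k r, (C * (1 / r) ^ (k * 3)) ^ 2 :=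
              Finset.sum_le_sum fun y _ => by
                rw [← sq_abs]; exact pow_le_pow_left₀ (abs_nonneg _) (hD y) 2
          _ = (latticeSimplex k r).card * (C * (1 / r) ^ (k * 3)) ^ 2 := by simp
          _ ≤ _ := by gcongr; exact card_latticeSimplex_le hr
    _ = (C ^ 2 * 2 ^ k) * r ^ k / (r ^ k) ^ 6 * T := by
        rw [pow_mul, mul_pow, mul_pow, one_div, inv_pow]; field_simp
    _ ≤ _ := by gcongr; linarith

end Expansion

section SelbergBound

set_option linter.unusedSectionVars false

open scoped Classical

variable {K : Type*} [Field K] [Fintype K]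

/-- Simultaneous congruences to pairwise coprime moduli are equidistributed. -/
theorem card_filter_congruences {k n : ℕ} {M : K[X]} (hM : M.Monic) (b : K[X])
    (h : Fin k → K[X]) {U : Fin k → Finset K[X]} (hU : ∀ j, ∀ p ∈ U j, IsPrimePoly p)
    (hMU : ∀ j, ∀ p ∈ U j, IsCoprime M p) (hdis : ∀ i j, i ≠ j → Disjoint (U i) (U j))
    (hdeg : M.natDegree + ∑ j, setDeg natDegree (U j) ≤ n) :
    ((monicFinset K n).filter (fun f => M ∣ f - b ∧ ∀ j, setProd (U j) ∣ f + h j)).card =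
      Fintype.card K ^ (n - (M.natDegree + ∑ j, setDeg natDegree (U j))) := by
  have hco1 : ∀ j, IsCoprime M (setProd (U j)) := fun j => IsCoprime.prod_right (hMU j)
  have hco2 : ∀ i j, i ≠ j → IsCoprime (setProd (U i)) (setProd (U j)) := fun i j hij =>
    IsCoprime.prod_left fun p hp => IsCoprime.prod_right fun p' hp' =>
      (hU i p hp).isCoprime (hU j p' hp') fun h =>
        Finset.disjoint_left.1 (hdis i j hij) hp (h ▸ hp')
  set mods : Option (Fin k) → K[X] := fun o => o.elim M fun j => setProd (U j) with hmods
  have hmco : ∀ o o', o ≠ o' → IsCoprime (mods o) (mods o') := by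
    rintro (_ | i) (_ | j) hne
    · exact absurd rfl hne
    · exact hco1 j
    · exact (hco1 i).symm
    · exact hco2 i j fun h => hne (by rw [h])
  obtain ⟨a, ha⟩ := Ideal.exists_forall_sub_mem_ideal (I := fun o => Ideal.span {mods o})
    (fun o o' hne => (Ideal.isCoprime_span_singleton_iff _ _).2 (hmco o o' hne))
    (fun o => o.elim b fun j => -h j)
  have hab : M ∣ a - b := Ideal.mem_span_singleton.1 (ha none)
  have hah : ∀ j, setProd (U j) ∣ a + h j := fun j => by
    have := Ideal.mem_span_singleton.1 (ha (some j))
    simpa [hmods] using this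
  set Q := M * ∏ j, setProd (U j) with hQ
  have hpm : (∏ j, setProd (U j)).Monic :=
    monic_prod_of_monic _ _ fun j _ => setProd_monic (hU j)
  have hQm : Q.Monic := hM.mul hpm
  have hQd : Q.natDegree = M.natDegree + ∑ j, setDeg natDegree (U j) := by
    rw [hQ, hM.natDegree_mul hpm, natDegree_prod_of_monic _ _ fun j _ => setProd_monic (hU j)]
    simp only [natDegree_setProd (hU _)]
  rw [← hQd] at hdeg ⊢
  rw [← card_monicFinset_filter hQm hdeg a]
  congr 1
  refine Finset.filter_congr fun f _ => ?_
  constructor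
  · rintro ⟨h1, h2⟩
    refine IsCoprime.mul_dvd (IsCoprime.prod_right fun j _ => hco1 j) ?_ ?_
    · have := dvd_sub h1 hab
      rwa [sub_sub_sub_cancel_right] at this
    · refine Finset.prod_dvd_of_coprime (fun i _ j _ hij => hco2 i j hij) fun j _ => ?_
      have := dvd_sub (h2 j) (hah j)
      rwa [add_sub_add_right_eq_sub] at this
  · intro hd
    refine ⟨?_, fun j => ?_⟩
    · have := dvd_add ((dvd_mul_right M _).trans hd) hab
      rwa [sub_add_sub_cancel] at this
    · have h1 : setProd (U j) ∣ f - a :=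
        ((Finset.dvd_prod_of_mem (fun j => setProd (U j)) (Finset.mem_univ j)).trans
          (dvd_mul_left _ M)).trans hd
      have := dvd_add h1 (hah j)
      rwa [show f - a + (a + h j) = f + h j by ring] at this

/-- `∑ μ(d) β(deg d)` over the squarefree `d ∣ g` with all prime factors in `R`. -/
def divisorSum (R : Finset K[X]) (β : ℕ → ℝ) (g : K[X]) : ℝ :=
  ∑ D ∈ R.powerset, if setProd D ∣ g then (-1) ^ D.card * β (setDeg natDegree D) else 0

theorem divisorSum_sq {R : Finset K[X]} (hR : ∀ p ∈ R, IsPrimePoly p) (β : ℕ → ℝ) (g : K[X]) :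
    divisorSum R β g ^ 2 = ∑ x ∈ R.powerset ×ˢ R.powerset,
      if setProd (x.1 ∪ x.2) ∣ g then (-1) ^ (x.1.card + x.2.card) *
        (β (setDeg natDegree x.1) * β (setDeg natDegree x.2)) else 0 := by
  rw [sq, divisorSum, Finset.sum_mul_sum, ← Finset.sum_product']
  refine Finset.sum_congr rfl fun x hx => ?_
  obtain ⟨h1, h2⟩ := Finset.mem_product.1 hx
  rw [Finset.mem_powerset] at h1 h2
  have hiff : setProd (x.1 ∪ x.2) ∣ g ↔ setProd x.1 ∣ g ∧ setProd x.2 ∣ g := by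
    rw [setProd_dvd_iff fun p hp => hR p (Finset.union_subset h1 h2 hp),
      setProd_dvd_iff fun p hp => hR p (h1 hp), setProd_dvd_iff fun p hp => hR p (h2 hp),
      Finset.forall_mem_union]
  by_cases ha : setProd x.1 ∣ g <;> by_cases hb : setProd x.2 ∣ g <;> simp [hiff, ha, hb]
  rw [pow_add]; ring

/-- Upper bound for the mean square of a product of sieve sums over an arithmetic progression. -/
theorem sum_prod_divisorSum_sq_le {k n : ℕ} {V V₀ : Finset K[X]}
    (hV : V ⊆ primesBelow K (n + 1)) (hV₀ : V₀ ⊆ V) {M : K[X]} (hM : M.Monic) (b : K[X])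
    (hMR : ∀ p ∈ primesBelow K (n + 1) \ V, IsCoprime M p) (h : Fin k → K[X])
    (hh : ∀ i j, i ≠ j → ∀ p ∈ primesBelow K (n + 1) \ V, ¬ p ∣ h i - h j)
    (hN : ∀ p ∈ primesBelow K (n + 1) \ V, 16 ≤ polyNorm p)
    {β : Fin k → ℕ → ℝ} {l : Fin k → ℕ} {B : Fin k → ℝ}
    (hβ : ∀ j, SlopeBound (β j) (l j) (B j)) (hB : ∀ j, 0 ≤ B j)
    (hdeg : M.natDegree + 2 * ∑ j, l j ≤ n) :
    ∑ f ∈ (monicFinset K n).filter (fun f => M ∣ f - b),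
      ∏ j, divisorSum (primesBelow K (n + 1) \ V) (β j) (f + h j) ^ 2 ≤
    (Fintype.card K : ℝ) ^ n / polyNorm M *
      ((∏ j, (Real.exp 4 * B j ^ 2 * eulerFactor polyNorm V ^ 2 *
      (eulerFactor polyNorm V₀)⁻¹ * (l j + setDeg natDegree V₀ + 1))) *
        Real.exp (2 ^ k * k * 256)) := by
  set R := primesBelow K (n + 1) \ V with hR
  have hq := card_pos_real (K := K)
  have hRp : ∀ p ∈ R, IsPrimePoly p := fun p hp =>
    (mem_primesBelow.1 (Finset.sdiff_subset hp)).1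
  set c : Fin k → Finset K[X] × Finset K[X] → ℝ := fun j x => (-1) ^ (x.1.card + x.2.card) *
        (β j (setDeg natDegree x.1) * β j (setDeg natDegree x.2)) with hc
  have h1 : ∑ f ∈ (monicFinset K n).filter (fun f => M ∣ f - b),
      ∏ j, divisorSum R (β j) (f + h j) ^ 2 =
      ∑ x ∈ Fintype.piFinset (fun _ : Fin k => R.powerset ×ˢ R.powerset),
        ((monicFinset K n).filter (fun f => M ∣ f - b ∧
          ∀ j, setProd ((x j).1 ∪ (x j).2) ∣ f + h j)).card * ∏ j, c j (x j) := by
    have : ∀ f, ∏ j, divisorSum R (β j) (f + h j) ^ 2 =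
        ∑ x ∈ Fintype.piFinset (fun _ : Fin k => R.powerset ×ˢ R.powerset),
        if ∀ j, setProd ((x j).1 ∪ (x j).2) ∣ f + h j then ∏ j, c j (x j) else 0 := by
      intro f
      simp only [divisorSum_sq hRp]
      rw [Finset.prod_univ_sum]
      refine Finset.sum_congr rfl fun x _ => ?_
      split_ifs with hx
      · exact Finset.prod_congr rfl fun j _ => if_pos (hx j)
      · push Not at hx
        obtain ⟨j, hj⟩ := hx
        exact Finset.prod_eq_zero (Finset.mem_univ j) (if_neg hj)
    rw [Finset.sum_congr rfl fun f _ => this f, Finset.sum_comm]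
    refine Finset.sum_congr rfl fun x _ => ?_
    rw [← Finset.sum_filter, Finset.sum_const, nsmul_eq_mul, Finset.filter_filter]
  have h2 : ∀ x ∈ Fintype.piFinset (fun _ : Fin k => R.powerset ×ˢ R.powerset),
      (((monicFinset K n).filter (fun f => M ∣ f - b ∧
          ∀ j, setProd ((x j).1 ∪ (x j).2) ∣ f + h j)).card : ℝ) * ∏ j, c j (x j) =
      (Fintype.card K : ℝ) ^ n / polyNorm M *
      if ∀ p ∈ R, (Finset.univ.filter (fun j => p ∈ (x j).1 ∪ (x j).2)).card ≤ 1 then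
        ∏ j, ((-1) ^ ((x j).1.card + (x j).2.card) / setNorm polyNorm ((x j).1 ∪ (x j).2) *
          (β j (setDeg natDegree (x j).1) * β j (setDeg natDegree (x j).2))) else 0 := by
    intro x hx
    have hxR : ∀ j, (x j).1 ⊆ R ∧ (x j).2 ⊆ R := fun j => by
      have := Finset.mem_product.1 (Fintype.mem_piFinset.1 hx j)
      exact ⟨Finset.mem_powerset.1 this.1, Finset.mem_powerset.1 this.2⟩
    have hxU : ∀ j, (x j).1 ∪ (x j).2 ⊆ R := fun j => Finset.union_subset (hxR j).1 (hxR j).2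
    split_ifs with hcop
    · by_cases hbig : ∃ j, l j < setDeg natDegree (x j).1 ∨ l j < setDeg natDegree (x j).2
      · obtain ⟨j, hj⟩ := hbig
        have hz : β j (setDeg natDegree (x j).1) * β j (setDeg natDegree (x j).2) = 0 := by
          rcases hj with hj | hj
          · rw [(hβ j).supp _ hj, zero_mul]
          · rw [(hβ j).supp _ hj, mul_zero]
        rw [Finset.prod_eq_zero (Finset.mem_univ j) (by simp only [hc]; rw [hz, mul_zero]),
          Finset.prod_eq_zero (Finset.mem_univ j) (by rw [hz, mul_zero])]
        simp
      · push Not at hbig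
        have hdis : ∀ i j, i ≠ j → Disjoint ((x i).1 ∪ (x i).2) ((x j).1 ∪ (x j).2) := by
          intro i j hij
          refine Finset.disjoint_left.2 fun p hi hj => hij ?_
          exact Finset.card_le_one.1 (hcop p (hxU i hi)) i (by simpa using hi) j (by simpa using hj)
        have hsum : ∑ j, setDeg natDegree ((x j).1 ∪ (x j).2) ≤ 2 * ∑ j, l j := by
          rw [Finset.mul_sum]
          refine Finset.sum_le_sum fun j _ => ?_
          have : setDeg natDegree ((x j).1 ∪ (x j).2) + setDeg natDegree ((x j).1 ∩ (x j).2) =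
              setDeg natDegree (x j).1 + setDeg natDegree (x j).2 := Finset.sum_union_inter
          have := hbig j
          omega
        have hdeg' : M.natDegree + ∑ j, setDeg natDegree ((x j).1 ∪ (x j).2) ≤ n := by omega
        rw [card_filter_congruences hM b h (fun j p hp => hRp p (hxU j hp))
          (fun j p hp => hMR p (hxU j hp)) hdis hdeg']
        have hpow : (Fintype.card K : ℝ) ^ n =
            (Fintype.card K : ℝ) ^ (n - (M.natDegree +
              ∑ j, setDeg natDegree ((x j).1 ∪ (x j).2))) *
            (polyNorm M * ∏ j, setNorm polyNorm ((x j).1 ∪ (x j).2)) := by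
          simp only [setNorm_polyNorm, polyNorm, Finset.prod_pow_eq_pow_sum]
          rw [← pow_add, ← pow_add]
          congr 1; omega
        have hMp : 0 < polyNorm M := by unfold polyNorm; positivity
        have hSp : ∀ j, 0 < setNorm polyNorm ((x j).1 ∪ (x j).2) := fun j => by
          rw [setNorm_polyNorm]; positivity
        have hPp : 0 < ∏ j, setNorm polyNorm ((x j).1 ∪ (x j).2) :=
          Finset.prod_pos fun j _ => hSp j
        have hcc : ∏ j, ((-1) ^ ((x j).1.card + (x j).2.card) /
            setNorm polyNorm ((x j).1 ∪ (x j).2) *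
            (β j (setDeg natDegree (x j).1) * β j (setDeg natDegree (x j).2))) =
            (∏ j, c j (x j)) / ∏ j, setNorm polyNorm ((x j).1 ∪ (x j).2) := by
          rw [← Finset.prod_div_distrib]
          refine Finset.prod_congr rfl fun j _ => ?_
          simp only [hc]; ring
        rw [hcc, hpow]
        push_cast
        field_simp
    · push Not at hcop
      obtain ⟨p, hp, hcard⟩ := hcop
      obtain ⟨i, hi, j, hj, hij⟩ := Finset.one_lt_card.1 hcard
      simp only [Finset.mem_filter, Finset.mem_univ, true_and] at hi hj
      have : (monicFinset K n).filter (fun f => M ∣ f - b ∧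
          ∀ j, setProd ((x j).1 ∪ (x j).2) ∣ f + h j) = ∅ := by
        refine Finset.filter_eq_empty_iff.2 fun f _ hf => hh i j hij p hp ?_
        have := dvd_sub ((Finset.dvd_prod_of_mem _ hi).trans (hf.2 i))
          ((Finset.dvd_prod_of_mem _ hj).trans (hf.2 j))
        rwa [add_sub_add_left_eq_sub] at this
      rw [this]; simp
  rw [h1, Finset.sum_congr rfl h2, ← Finset.mul_sum]
  refine mul_le_mul_of_nonneg_left (le_trans (le_abs_self _) ?_) (by unfold polyNorm; positivity)
  refine (primeSystem_primesBelow n).abs_coupled_le hV hV₀ hβ (fun j => ?_) hB hN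
  have := Finset.single_le_sum (f := l) (fun i _ => Nat.zero_le _) (Finset.mem_univ j)
  omega

/-- If a prime `p` of `R` divides `g`, the divisors of `g` can be paired according to whether
they are divisible by `p`. -/
theorem divisorSum_eq_of_dvd {R : Finset K[X]} (hR : ∀ p ∈ R, IsPrimePoly p) {p : K[X]}
    (hp : p ∈ R) (β : ℕ → ℝ) {g : K[X]} (hg : p ∣ g) :
    divisorSum R β g = divisorSum (R.erase p) (fun x => β x - β (x + p.natDegree)) g := by
  unfold divisorSum
  conv_lhs => rw [← Finset.insert_erase hp]
  rw [Finset.sum_powerset_insert (Finset.notMem_erase p R), ← Finset.sum_add_distrib]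
  refine Finset.sum_congr rfl fun D hD => ?_
  have hDR := Finset.mem_powerset.1 hD
  have hpD : p ∉ D := fun h => Finset.notMem_erase p R (hDR h)
  have hDp : ∀ p' ∈ D, IsPrimePoly p' := fun p' hp' => hR p' (Finset.mem_of_mem_erase (hDR hp'))
  have hiff : setProd (insert p D) ∣ g ↔ setProd D ∣ g := by
    rw [setProd_dvd_iff hDp, setProd_dvd_iff, Finset.forall_mem_insert]
    · exact and_iff_right hg
    · rw [Finset.forall_mem_insert]; exact ⟨hR p hp, hDp⟩
  rw [setDeg_insert hpD, Finset.card_insert_of_notMem hpD, add_comm p.natDegree]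
  simp only [hiff]
  split_ifs
  · rw [pow_succ]; ring
  · simp

theorem divisorSum_eq_of_not_dvd {R : Finset K[X]} {p : K[X]} (hp : p ∈ R)
    (β : ℕ → ℝ) {g : K[X]} (hg : ¬ p ∣ g) : divisorSum R β g = divisorSum (R.erase p) β g := by
  unfold divisorSum
  conv_lhs => rw [← Finset.insert_erase hp]
  rw [Finset.sum_powerset_insert (Finset.notMem_erase p R)]
  have : ∀ D ∈ (R.erase p).powerset, (if setProd (insert p D) ∣ g then
      (-1 : ℝ) ^ (insert p D).card * β (setDeg natDegree (insert p D)) else 0) = 0 := by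
    intro D _
    have hd : p ∣ setProd (insert p D) :=
      Finset.dvd_prod_of_mem (fun q => q) (Finset.mem_insert_self p D)
    exact if_neg fun h => hg (hd.trans h)
  rw [Finset.sum_congr rfl this]; simp

end SelbergBound

section Conversion

set_option linter.unusedSectionVars false

open scoped Classical

variable {K : Type*} [Field K] [Fintype K]

theorem dvd_setProd_of_mem {D : Finset K[X]} {p : K[X]} (hp : p ∈ D) : p ∣ setProd D :=
  Finset.dvd_prod_of_mem (fun q => q) hp

theorem squarefree_setProd {D : Finset K[X]} (hD : ∀ p ∈ D, IsPrimePoly p) :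
    Squarefree (setProd D) :=
  Finset.squarefree_prod_of_pairwise_isCoprime
    (fun p hp p' hp' hne => ((hD p hp).isCoprime (hD p' hp') hne).isRelPrime)
    fun p hp => (hD p hp).2.squarefree

theorem moebius_setProd {D : Finset K[X]} (hD : ∀ p ∈ D, IsPrimePoly p) :
    moebius (setProd D) = (-1) ^ D.card := by
  unfold moebius
  rw [if_pos (squarefree_setProd hD)]
  congr 1
  have hne := (setProd_monic hD).ne_zero
  have hassoc := UniqueFactorizationMonoid.factors_prod hne
  have hval : setProd D = D.val.prod := by rw [Finset.prod_val]; rfl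
  refine Multiset.card_eq_card_of_rel (r := Associated) ?_
  refine UniqueFactorizationMonoid.factors_unique
    (fun x hx => UniqueFactorizationMonoid.irreducible_of_factor x hx)
    (fun x hx => (hD x hx).2) ?_
  rw [← hval]; exact hassoc

theorem exists_setProd_eq {d : K[X]} (hd : d.Monic) (hsq : Squarefree d) :
    ∃ D : Finset K[X], (∀ p ∈ D, IsPrimePoly p) ∧ setProd D = d := by
  have hne := hd.ne_zero
  have hnd := (UniqueFactorizationMonoid.squarefree_iff_nodup_normalizedFactors hne).1 hsq
  refine ⟨(UniqueFactorizationMonoid.normalizedFactors d).toFinset, fun p hp => ?_, ?_⟩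
  · rw [Multiset.mem_toFinset] at hp
    have hirr := UniqueFactorizationMonoid.irreducible_of_normalized_factor p hp
    refine ⟨?_, hirr⟩
    rw [← UniqueFactorizationMonoid.normalize_normalized_factor p hp]
    exact monic_normalize hirr.ne_zero
  · have h1 := UniqueFactorizationMonoid.prod_normalizedFactors_eq hne
    rw [hd.normalize_eq_self] at h1
    rw [setProd, Finset.prod, Multiset.toFinset_val, Multiset.dedup_eq_self.2 hnd]
    simpa using h1

/-- The sieve sum at `f` as a sum over tuples of finite sets of primes. -/
theorem finsum_sieveWeight_eq {k n w : ℕ} (F : (Fin k → ℝ) → ℝ) (r : ℝ) (h : Fin k → K[X])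
    {f : K[X]} (hf : ∀ j, f + h j ≠ 0 ∧ (f + h j).natDegree ≤ n)
    (hh : ∀ i j, i ≠ j → ∀ p ∈ primesBelow K (n + 1) \ primesBelow K w, ¬ p ∣ h i - h j) :
    ∑ᶠ d ∈ sieveTuples h w f, sieveWeight F r d =
      ∑ D ∈ Fintype.piFinset (fun j =>
        (primesBelow K (n + 1) \ primesBelow K w).powerset.filter (fun D => setProd D ∣ f + h j)),
        (∏ j, (-1 : ℝ) ^ (D j).card) * F (fun j => (setDeg natDegree (D j) : ℝ) / r) := by
  set R := primesBelow K (n + 1) \ primesBelow K w with hR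
  have hRp : ∀ p ∈ R, IsPrimePoly p := fun p hp =>
    (mem_primesBelow.1 (Finset.sdiff_subset hp)).1
  have hfin := finite_sieveTuples h w f fun j => (hf j).1
  rw [finsum_mem_eq_finite_toFinset_sum _ hfin]
  set A := Fintype.piFinset (fun j => R.powerset.filter (fun D => setProd D ∣ f + h j)) with hA
  have hmem : ∀ D, D ∈ A ↔ ∀ j, D j ⊆ R ∧ setProd (D j) ∣ f + h j := by
    intro D; simp [hA]
  have hinj : Set.InjOn (fun (D : Fin k → Finset K[X]) j => setProd (D j))
      (A : Set (Fin k → Finset K[X])) := by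
    intro D hD E hE hDE
    ext1 j
    exact setProd_injOn hRp (Finset.mem_powerset.2 ((hmem D).1 hD j).1)
      (Finset.mem_powerset.2 ((hmem E).1 hE j).1) (congrFun hDE j)
  have h1 : ∑ D ∈ A, (∏ j, (-1 : ℝ) ^ (D j).card) *
      F (fun j => (setDeg natDegree (D j) : ℝ) / r) =
      ∑ d ∈ A.image (fun D j => setProd (D j)), sieveWeight F r d := by
    rw [Finset.sum_image hinj]
    refine Finset.sum_congr rfl fun D hD => ?_
    have hDp : ∀ j, ∀ p ∈ D j, IsPrimePoly p := fun j p hp => hRp p (((hmem D).1 hD j).1 hp)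
    unfold sieveWeight
    simp only [moebius_setProd (hDp _), natDegree_setProd (hDp _)]
  rw [h1]
  symm
  refine Finset.sum_subset ?_ ?_
  · intro d hd
    obtain ⟨D, hD, rfl⟩ := Finset.mem_image.1 hd
    have hD := (hmem D).1 hD
    have hDp : ∀ j, ∀ p ∈ D j, IsPrimePoly p := fun j p hp => hRp p ((hD j).1 hp)
    rw [Set.Finite.mem_toFinset]
    refine ⟨fun j => setProd_monic (hDp j), fun i j hij => ?_, fun j => ?_, fun j => (hD j).2⟩
    · refine IsCoprime.prod_left fun p hp => IsCoprime.prod_right fun p' hp' => ?_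
      refine (hDp i p hp).isCoprime (hDp j p' hp') ?_
      rintro rfl
      refine hh i j hij p ((hD i).1 hp) ?_
      have := dvd_sub ((dvd_setProd_of_mem hp).trans (hD i).2)
        ((dvd_setProd_of_mem hp').trans (hD j).2)
      rwa [add_sub_add_left_eq_sub] at this
    · rw [primorial_eq]
      refine IsCoprime.prod_left fun p hp => IsCoprime.prod_right fun p' hp' => ?_
      refine (hDp j p hp).isCoprime (mem_primesBelow.1 hp').1 ?_
      rintro rfl
      exact (Finset.mem_sdiff.1 ((hD j).1 hp)).2 hp'
  · intro d hd hdA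
    rw [Set.Finite.mem_toFinset] at hd
    obtain ⟨hmon, -, hcoW, hdvd⟩ := hd
    by_contra hne
    refine hdA ?_
    have hsq : ∀ j, Squarefree (d j) := by
      intro j
      by_contra hns
      refine hne ?_
      unfold sieveWeight
      rw [Finset.prod_eq_zero (Finset.mem_univ j), zero_mul]
      unfold moebius
      rw [if_neg hns]
    choose D hDp hDd using fun j => exists_setProd_eq (hmon j) (hsq j)
    refine Finset.mem_image.2 ⟨D, (hmem D).2 fun j => ⟨fun p hp => ?_, by rw [hDd]; exact hdvd j⟩,
      funext hDd⟩
    have hpd : p ∣ d j := by rw [← hDd j]; exact dvd_setProd_of_mem hp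
    refine Finset.mem_sdiff.2 ⟨mem_primesBelow.2 ⟨hDp j p hp, ?_⟩, fun hpw => ?_⟩
    · have := (natDegree_le_of_dvd (hpd.trans (hdvd j)) (hf j).1).trans (hf j).2
      omega
    · have hpW : p ∣ primorial K w := by rw [primorial_eq]; exact dvd_setProd_of_mem hpw
      exact (hDp j p hp).2.not_isUnit ((hcoW j).isUnit_of_dvd' hpd hpW)

/-- The sieve sum is bounded in mean square by products of one-dimensional divisor sums. -/
theorem IsSieveFunction.exists_sq_sieveSum_le {k : ℕ} {F : (Fin k → ℝ) → ℝ}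
    (hF : IsSieveFunction F) :
    ∃ C : ℝ, 0 < C ∧ ∀ r : ℝ, 1 ≤ r → ∀ (n w : ℕ) (h : Fin k → K[X]) (f : K[X]),
      (∀ j, f + h j ≠ 0 ∧ (f + h j).natDegree ≤ n) →
      (∀ i j, i ≠ j → ∀ p ∈ primesBelow K (n + 1) \ primesBelow K w, ¬ p ∣ h i - h j) →
      (∑ᶠ d ∈ sieveTuples h w f, sieveWeight F r d) ^ 2 ≤
        C * r ^ k / (r ^ k) ^ 6 * ∑ y ∈ latticeSimplex k r,
          ∏ j, divisorSum (primesBelow K (n + 1) \ primesBelow K w) (quadWeight (y j))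
            (f + h j) ^ 2 := by
  obtain ⟨C, hC0, hC⟩ := hF.exists_sq_sum_le
  refine ⟨C, hC0, fun r hr n w h f hf hh => ?_⟩
  rw [finsum_sieveWeight_eq F r h hf hh]
  refine (hC r hr _ (fun D : Finset K[X] => (-1 : ℝ) ^ D.card) (setDeg natDegree)).trans
    (le_of_eq ?_)
  congr 1
  refine Finset.sum_congr rfl fun y _ => Finset.prod_congr rfl fun j _ => ?_
  rw [Finset.sum_filter]; rfl

/-- `∑ (deg p) ^ 2 / |p|` over the primes of degree less than `x` is at most `x ^ 2`. -/
theorem sum_sq_natDegree_div_le (w : ℕ) {x : ℝ} (hx : 0 ≤ x) :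
    ∑ p ∈ (primesBelow K w).filter (fun p => (p.natDegree : ℝ) < x),
      (p.natDegree : ℝ) ^ 2 / polyNorm p ≤ x ^ 2 := by
  have hq := card_pos_real (K := K)
  rw [Finset.sum_filter, sum_primesBelow_eq]
  calc _ ≤ ∑ m ∈ Finset.Ico 1 w, if (m : ℝ) < x then x else 0 := by
        refine Finset.sum_le_sum fun m hm => ?_
        rw [Finset.mem_Ico] at hm
        rw [Finset.sum_congr rfl (g := fun _ => if (m : ℝ) < x then
          (m : ℝ) ^ 2 / (Fintype.card K : ℝ) ^ m else 0) fun p hp => by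
          rw [polyNorm, (Finset.mem_filter.1 hp).2], Finset.sum_const, nsmul_eq_mul]
        split_ifs with hmx
        · have h1 : (((primesBelow K w).filter (fun p => p.natDegree = m)).card : ℝ) * m ≤
              (Fintype.card K : ℝ) ^ m := by
            exact_mod_cast mul_card_primesBelow_filter_le (K := K) hm.1 w
          calc _ = ((((primesBelow K w).filter (fun p => p.natDegree = m)).card : ℝ) * m) * m /
                (Fintype.card K : ℝ) ^ m := by ring
            _ ≤ (Fintype.card K : ℝ) ^ m * m / (Fintype.card K : ℝ) ^ m := by gcongr
            _ = m := by field_simp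
            _ ≤ x := hmx.le
        · simp
    _ ≤ ∑ m ∈ Finset.Ioc 0 ⌊x⌋₊, x := by
        rw [← Finset.sum_filter]
        refine Finset.sum_le_sum_of_subset_of_nonneg ?_ fun _ _ _ => hx
        intro m hm
        obtain ⟨hm, hmx⟩ := Finset.mem_filter.1 hm
        rw [Finset.mem_Ico] at hm
        exact Finset.mem_Ioc.2 ⟨hm.1, Nat.le_floor hmx.le⟩
    _ ≤ x ^ 2 := by
        rw [Finset.sum_const, Nat.card_Ioc, nsmul_eq_mul, sq]
        gcongr
        exact Nat.floor_le hx

end Conversion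

section Final

set_option linter.unusedSectionVars false

open scoped Classical

variable {K : Type*} [Field K] [Fintype K]

/-- The conditions on the size of `n` under which the sieve bounds hold. -/
structure SieveRange {k : ℕ} (h : Fin k → K[X]) (r : ℝ) (w n : ℕ) : Prop where
  one_le : 1 ≤ r
  le_succ : w ≤ n + 1
  deg_W : (setDeg natDegree (primesBelow K w) : ℝ) ≤ r
  norm : ∀ p ∈ primesBelow K (n + 1) \ primesBelow K w, 16 ≤ polyNorm p
  deg_h : ∀ j, (h j).natDegree < n
  not_dvd : ∀ i j, i ≠ j → ∀ p ∈ primesBelow K (n + 1) \ primesBelow K w, ¬ p ∣ h i - h j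

variable {k : ℕ} {h : Fin k → K[X]} {r : ℝ} {w n : ℕ}

theorem SieveRange.ne_zero (H : SieveRange h r w n) {f : K[X]} (hf : f ∈ monicFinset K n)
    (j : Fin k) : f + h j ≠ 0 ∧ (f + h j).natDegree = n := by
  have hf := mem_monicFinset.1 hf
  have hd : (f + h j).natDegree = n := by
    rw [natDegree_add_eq_left_of_natDegree_lt (by rw [hf.2]; exact H.deg_h j), hf.2]
  refine ⟨fun h0 => ?_, hd⟩
  have := H.deg_h j
  rw [h0, natDegree_zero] at hd
  omega

theorem SieveRange.subset (H : SieveRange h r w n) : primesBelow K w ⊆ primesBelow K (n + 1) := by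
  intro p hp
  have := mem_primesBelow.1 hp
  have := H.le_succ
  exact mem_primesBelow.2 ⟨by tauto, by omega⟩

theorem sum_le_of_mem_latticeSimplex {y : Fin k → ℕ} (hy : y ∈ latticeSimplex k r) (j : Fin k) :
    (y j : ℝ) ≤ r := by
  refine le_trans ?_ (mem_latticeSimplex hy)
  exact_mod_cast Finset.single_le_sum (f := y) (fun i _ => Nat.zero_le _) (Finset.mem_univ j)

/-- The bound for the sum over a whole residue class modulo `W`. -/
theorem SieveRange.sum_prod_le (H : SieveRange h r w n)
    (hdeg : (setDeg natDegree (primesBelow K w) : ℝ) + 2 * r ≤ n) (b : K[X])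
    {y : Fin k → ℕ} (hy : y ∈ latticeSimplex k r) :
    ∑ f ∈ (monicFinset K n).filter (fun f => primorial K w ∣ f - b),
      ∏ j, divisorSum (primesBelow K (n + 1) \ primesBelow K w) (quadWeight (y j)) (f + h j) ^ 2 ≤
    (Fintype.card K : ℝ) ^ n / polyNorm (primorial K w) *
      ((Real.exp 4 * 48 * r ^ 3 * eulerFactor polyNorm (primesBelow K w)) ^ k *
        Real.exp (2 ^ k * k * 256)) := by
  set V := primesBelow K w with hV
  have hVp : ∀ p ∈ V, IsPrimePoly p := isPrimePoly_of_mem subset_rfl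
  have hr := H.one_le
  have hE : 1 ≤ eulerFactor polyNorm V := one_le_eulerFactor fun p hp => two_le_polyNorm (hVp p hp)
  have hMd : (primorial K w).natDegree = setDeg natDegree V := by
    rw [primorial_eq, natDegree_setProd hVp]
  have hyr := mem_latticeSimplex hy
  refine (sum_prod_divisorSum_sq_le (V := V) (V₀ := V) H.subset subset_rfl
    (by rw [primorial_eq]; exact setProd_monic hVp) b ?_ h H.not_dvd H.norm
    (β := fun j => quadWeight (y j)) (l := y) (B := fun _ => 2 * r)
    (fun j => slopeBound_quadWeight (by linarith [sum_le_of_mem_latticeSimplex hy j]))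
    (fun _ => by linarith) ?_).trans ?_
  · intro p hp
    obtain ⟨hp1, hp2⟩ := Finset.mem_sdiff.1 hp
    rw [primorial_eq]
    refine IsCoprime.prod_left fun p' hp' => (hVp p' hp').isCoprime (mem_primesBelow.1 hp1).1 ?_
    rintro rfl; exact hp2 hp'
  · rw [hMd]
    have : ((setDeg natDegree V + 2 * ∑ j, y j : ℕ) : ℝ) ≤ n := by
      push_cast at hyr ⊢; linarith
    exact_mod_cast this
  · have hn : 0 ≤ (Fintype.card K : ℝ) ^ n / polyNorm (primorial K w) := by
      unfold polyNorm; positivity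
    refine mul_le_mul_of_nonneg_left (mul_le_mul_of_nonneg_right ?_ (Real.exp_pos _).le) hn
    have hk : (Real.exp 4 * 48 * r ^ 3 * eulerFactor polyNorm V) ^ k =
        ∏ _j : Fin k, (Real.exp 4 * 48 * r ^ 3 * eulerFactor polyNorm V) := by simp
    rw [hk]
    refine Finset.prod_le_prod (fun j _ => by positivity) fun j _ => ?_
    have hyj := sum_le_of_mem_latticeSimplex hy j
    have hW := H.deg_W
    calc _ ≤ Real.exp 4 * (2 * r) ^ 2 * eulerFactor polyNorm V ^ 2 *
          (eulerFactor polyNorm V)⁻¹ * (3 * r) := by gcongr; linarith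
      _ = Real.exp 4 * 12 * r ^ 3 * eulerFactor polyNorm V := by field_simp; ring
      _ ≤ _ := by gcongr; norm_num

/-- The bound for the sum over the `f` in a residue class modulo `W` such that a given prime `p`
divides `f + h i`. -/
theorem SieveRange.sum_prod_le_of_dvd (H : SieveRange h r w n) {p : K[X]}
    (hp : p ∈ primesBelow K (n + 1) \ primesBelow K w)
    (hdeg : (setDeg natDegree (primesBelow K w) : ℝ) + p.natDegree + 2 * r ≤ n) (b : K[X])
    (i : Fin k) {y : Fin k → ℕ} (hy : y ∈ latticeSimplex k r) :
    ∑ f ∈ (monicFinset K n).filter (fun f => primorial K w ∣ f - b ∧ p ∣ f + h i),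
      ∏ j, divisorSum (primesBelow K (n + 1) \ primesBelow K w) (quadWeight (y j)) (f + h j) ^ 2 ≤
    (Fintype.card K : ℝ) ^ n / polyNorm (primorial K w) *
      (((p.natDegree : ℝ) / r) ^ 2 / polyNorm p *
      ((Real.exp 4 * 48 * r ^ 3 * eulerFactor polyNorm (primesBelow K w)) ^ k *
        Real.exp (2 ^ k * k * 256))) := by
  set V := primesBelow K w with hV
  set R := primesBelow K (n + 1) \ V with hR
  obtain ⟨hpn, hpV⟩ := Finset.mem_sdiff.1 hp
  have hpp : IsPrimePoly p := (mem_primesBelow.1 hpn).1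
  have hVp : ∀ p ∈ V, IsPrimePoly p := isPrimePoly_of_mem subset_rfl
  have hRp : ∀ p ∈ R, IsPrimePoly p := isPrimePoly_of_mem Finset.sdiff_subset
  have hr := H.one_le
  have hE : 1 ≤ eulerFactor polyNorm V := one_le_eulerFactor fun p hp => two_le_polyNorm (hVp p hp)
  have hWm : (primorial K w).Monic := by rw [primorial_eq]; exact setProd_monic hVp
  have hMd : (primorial K w).natDegree = setDeg natDegree V := by
    rw [primorial_eq, natDegree_setProd hVp]
  have hcoR : ∀ p' ∈ R, IsCoprime (primorial K w) p' := by
    intro p' hp'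
    obtain ⟨hp1, hp2⟩ := Finset.mem_sdiff.1 hp'
    rw [primorial_eq]
    refine IsCoprime.prod_left fun p'' hp'' =>
      (hVp p'' hp'').isCoprime (mem_primesBelow.1 hp1).1 ?_
    rintro rfl; exact hp2 hp''
  have hcop := hcoR p hp
  have herase : R.erase p = primesBelow K (n + 1) \ insert p V := by
    ext x; simp only [hR, Finset.mem_erase, Finset.mem_sdiff, Finset.mem_insert]; tauto
  obtain ⟨u, v, huv⟩ := id hcop
  set b' := b * (v * p) - h i * (u * primorial K w) with hb'
  have hb1 : primorial K w ∣ b' - b := by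
    refine ⟨-(b * u) - h i * u, ?_⟩
    have : v * p = 1 - u * primorial K w := by rw [← huv]; ring
    rw [hb', this]; ring
  have hb2 : p ∣ b' + h i := by
    refine ⟨b * v + h i * v, ?_⟩
    have : u * primorial K w = 1 - v * p := by rw [← huv]; ring
    rw [hb', this]; ring
  have hfilter : (monicFinset K n).filter (fun f => primorial K w ∣ f - b ∧ p ∣ f + h i) =
      (monicFinset K n).filter (fun f => primorial K w * p ∣ f - b') := by
    refine Finset.filter_congr fun f _ => ?_
    constructor
    · rintro ⟨h1, h2⟩
      refine hcop.mul_dvd ?_ ?_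
      · have := dvd_sub h1 hb1
        rwa [sub_sub_sub_cancel_right] at this
      · have := dvd_sub h2 hb2
        rwa [add_sub_add_right_eq_sub] at this
    · intro hd
      constructor
      · have := dvd_add ((dvd_mul_right _ p).trans hd) hb1
        rwa [sub_add_sub_cancel] at this
      · have := dvd_add ((dvd_mul_left p _).trans hd) hb2
        rwa [show f - b' + (b' + h i) = f + h i by ring] at this
  set β : Fin k → ℕ → ℝ := fun j => if j = i then
    fun x => quadWeight (y i) x - quadWeight (y i) (x + p.natDegree) else quadWeight (y j) with hβ
  have hsum : ∑ f ∈ (monicFinset K n).filter (fun f => primorial K w ∣ f - b ∧ p ∣ f + h i),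
      ∏ j, divisorSum R (quadWeight (y j)) (f + h j) ^ 2 =
      ∑ f ∈ (monicFinset K n).filter (fun f => primorial K w * p ∣ f - b'),
      ∏ j, divisorSum (primesBelow K (n + 1) \ insert p V) (β j) (f + h j) ^ 2 := by
    rw [← hfilter, ← herase]
    refine Finset.sum_congr rfl fun f hf => Finset.prod_congr rfl fun j _ => ?_
    have hpf := (Finset.mem_filter.1 hf).2.2
    congr 1
    by_cases hj : j = i
    · subst hj
      simp only [hβ, if_true]
      exact divisorSum_eq_of_dvd hRp hp _ hpf
    · simp only [hβ, if_neg hj]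
      refine divisorSum_eq_of_not_dvd hp _ fun hd => H.not_dvd j i hj p hp ?_
      have := dvd_sub hd hpf
      rwa [add_sub_add_left_eq_sub] at this
  have hyr := mem_latticeSimplex hy
  have hsubR : primesBelow K (n + 1) \ insert p V ⊆ R := by
    rw [← herase]; exact Finset.erase_subset _ _
  rw [hsum]
  refine (sum_prod_divisorSum_sq_le (V := insert p V) (V₀ := V)
    (Finset.insert_subset hpn H.subset) (Finset.subset_insert p V)
    (hWm.mul hpp.1) b' ?_ h (fun i j hij p' hp' => H.not_dvd i j hij p' (hsubR hp'))
    (fun p' hp' => H.norm p' (hsubR hp'))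
    (β := β) (l := y) (B := fun j => if j = i then (p.natDegree : ℝ) else 2 * r)
    (fun j => ?_) (fun j => ?_) ?_).trans ?_
  · intro p' hp'
    refine IsCoprime.mul_left (hcoR p' (hsubR hp')) (hpp.isCoprime (hRp p' (hsubR hp')) ?_)
    rintro rfl
    exact (Finset.mem_sdiff.1 hp').2 (Finset.mem_insert_self _ _)
  · simp only [hβ]
    split_ifs with hj
    · subst hj; exact slopeBound_quadWeight_sub _ _
    · exact slopeBound_quadWeight (by linarith [sum_le_of_mem_latticeSimplex hy j])
  · split_ifs <;> positivity
  · rw [hWm.natDegree_mul hpp.1, hMd]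
    have : ((setDeg natDegree V + p.natDegree + 2 * ∑ j, y j : ℕ) : ℝ) ≤ n := by
      push_cast at hyr ⊢; linarith
    exact_mod_cast this
  · have hnorm : polyNorm (primorial K w * p) = polyNorm (primorial K w) * polyNorm p := by
      unfold polyNorm; rw [hWm.natDegree_mul hpp.1, pow_add]
    have hq := card_pos_real (K := K)
    have hWpos : 0 < polyNorm (primorial K w) := by unfold polyNorm; positivity
    have hppos : 0 < polyNorm p := by unfold polyNorm; positivity
    have hEp : eulerFactor polyNorm (insert p V) ≤ 2 * eulerFactor polyNorm V := by
      have : eulerFactor polyNorm (insert p V) =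
          eulerFactor polyNorm {p} * eulerFactor polyNorm V := by
        rw [Finset.insert_eq, eulerFactor_union (Finset.disjoint_singleton_left.2 hpV)]
      rw [this]
      gcongr
      have := eulerFactor_le_two_pow (N := polyNorm) (V := {p})
        (by simpa using two_le_polyNorm hpp)
      simpa using this
    have hE1 : 1 ≤ eulerFactor polyNorm (insert p V) := one_le_eulerFactor fun x hx => by
      rcases Finset.mem_insert.1 hx with rfl | hx
      · exact two_le_polyNorm hpp
      · exact two_le_polyNorm (hVp x hx)
    have hprod : ∏ j, (Real.exp 4 * (if j = i then (p.natDegree : ℝ) else 2 * r) ^ 2 *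
        eulerFactor polyNorm (insert p V) ^ 2 *
        (eulerFactor polyNorm V)⁻¹ * (y j + setDeg natDegree V + 1)) ≤
        ((p.natDegree : ℝ) / r) ^ 2 *
          (Real.exp 4 * 48 * r ^ 3 * eulerFactor polyNorm V) ^ k := by
      have hk : ((p.natDegree : ℝ) / r) ^ 2 *
          (Real.exp 4 * 48 * r ^ 3 * eulerFactor polyNorm V) ^ k =
          ∏ j : Fin k, ((if j = i then ((p.natDegree : ℝ) / r) ^ 2 else 1) *
            (Real.exp 4 * 48 * r ^ 3 * eulerFactor polyNorm V)) := by
        rw [Finset.prod_mul_distrib, Finset.prod_ite_eq']; simp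
      rw [hk]
      refine Finset.prod_le_prod (fun j _ => by positivity) fun j _ => ?_
      have hyj := sum_le_of_mem_latticeSimplex hy j
      have hW := H.deg_W
      have hb : ((if j = i then (p.natDegree : ℝ) else 2 * r)) ^ 2 ≤
          (if j = i then ((p.natDegree : ℝ) / r) ^ 2 else 1) * (4 * r ^ 2) := by
        split_ifs
        · rw [div_pow]; field_simp; nlinarith [sq_nonneg (p.natDegree : ℝ)]
        · nlinarith
      have hs0 : 0 ≤ (if j = i then ((p.natDegree : ℝ) / r) ^ 2 else 1) := by
        split_ifs <;> positivity
      set s := (if j = i then ((p.natDegree : ℝ) / r) ^ 2 else 1) with hs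
      calc _ ≤ Real.exp 4 * (s * (4 * r ^ 2)) * (2 * eulerFactor polyNorm V) ^ 2 *
          (eulerFactor polyNorm V)⁻¹ * (3 * r) := by gcongr; linarith
        _ = _ := by field_simp; ring
    calc _ ≤ (Fintype.card K : ℝ) ^ n / polyNorm (primorial K w * p) *
        ((((p.natDegree : ℝ) / r) ^ 2 *
          (Real.exp 4 * 48 * r ^ 3 * eulerFactor polyNorm V) ^ k) *
            Real.exp (2 ^ k * k * 256)) := by
          refine mul_le_mul_of_nonneg_left
            (mul_le_mul_of_nonneg_right hprod (Real.exp_pos _).le) ?_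
          unfold polyNorm; positivity
      _ = _ := by rw [hnorm]; field_simp

/-- The mean square of the sieve sums over a set of polynomials, from a bound for products of
one-dimensional divisor sums. -/
theorem SieveRange.sum_sq_le {F : (Fin k → ℝ) → ℝ} {C : ℝ} (hC0 : 0 < C)
    (hC : ∀ r : ℝ, 1 ≤ r → ∀ (n w : ℕ) (h : Fin k → K[X]) (f : K[X]),
      (∀ j, f + h j ≠ 0 ∧ (f + h j).natDegree ≤ n) →
      (∀ i j, i ≠ j → ∀ p ∈ primesBelow K (n + 1) \ primesBelow K w, ¬ p ∣ h i - h j) →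
      (∑ᶠ d ∈ sieveTuples h w f, sieveWeight F r d) ^ 2 ≤
        C * r ^ k / (r ^ k) ^ 6 * ∑ y ∈ latticeSimplex k r,
          ∏ j, divisorSum (primesBelow K (n + 1) \ primesBelow K w) (quadWeight (y j))
            (f + h j) ^ 2)
    (H : SieveRange h r w n) {A : Finset K[X]} (hA : A ⊆ monicFinset K n) {lam : ℝ}
    (hlam : 0 ≤ lam) (hS : ∀ y ∈ latticeSimplex k r,
      ∑ f ∈ A, ∏ j, divisorSum (primesBelow K (n + 1) \ primesBelow K w) (quadWeight (y j))
        (f + h j) ^ 2 ≤ (Fintype.card K : ℝ) ^ n / polyNorm (primorial K w) *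
      (lam * ((Real.exp 4 * 48 * r ^ 3 * eulerFactor polyNorm (primesBelow K w)) ^ k *
        Real.exp (2 ^ k * k * 256)))) :
    ∑ f ∈ A, (∑ᶠ d ∈ sieveTuples h w f, sieveWeight F r d) ^ 2 ≤
      C * (Real.exp 4 * 96) ^ k * Real.exp (2 ^ k * k * 256) * lam *
      ((Fintype.card K : ℝ) ^ n / polyNorm (primorial K w) *
        eulerFactor polyNorm (primesBelow K w) ^ k / r ^ k) := by
  have hr := H.one_le
  have hr0 : 0 < r := by linarith
  have hq := card_pos_real (K := K)
  have hE : 1 ≤ eulerFactor polyNorm (primesBelow K w) := one_le_eulerFactor fun p hp =>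
    two_le_polyNorm (mem_primesBelow.1 hp).1
  have hWpos : 0 < polyNorm (primorial K w) := by unfold polyNorm; positivity
  set E := eulerFactor polyNorm (primesBelow K w) with hEdef
  set T := (Fintype.card K : ℝ) ^ n / polyNorm (primorial K w) *
      (lam * ((Real.exp 4 * 48 * r ^ 3 * E) ^ k * Real.exp (2 ^ k * k * 256))) with hT
  have hT0 : 0 ≤ T := by positivity
  calc _ ≤ ∑ f ∈ A, C * r ^ k / (r ^ k) ^ 6 * ∑ y ∈ latticeSimplex k r,
          ∏ j, divisorSum (primesBelow K (n + 1) \ primesBelow K w) (quadWeight (y j))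
            (f + h j) ^ 2 :=
        Finset.sum_le_sum fun f hf => hC r hr n w h f (fun j =>
          ⟨(H.ne_zero (hA hf) j).1, (H.ne_zero (hA hf) j).2.le⟩) H.not_dvd
    _ = C * r ^ k / (r ^ k) ^ 6 * ∑ y ∈ latticeSimplex k r, ∑ f ∈ A,
          ∏ j, divisorSum (primesBelow K (n + 1) \ primesBelow K w) (quadWeight (y j))
            (f + h j) ^ 2 := by rw [← Finset.mul_sum, Finset.sum_comm]
    _ ≤ C * r ^ k / (r ^ k) ^ 6 * ∑ y ∈ latticeSimplex k r, T := by
        gcongr with y hy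
        exact hS y hy
    _ = C * r ^ k / (r ^ k) ^ 6 * ((latticeSimplex k r).card * T) := by simp
    _ ≤ C * r ^ k / (r ^ k) ^ 6 * ((2 * r) ^ k * T) := by
        gcongr
        exact card_latticeSimplex_le hr
    _ = _ := by
        have e1 : (Real.exp 4 * 48 * r ^ 3 * E) ^ k =
            (Real.exp 4 * 48) ^ k * (r ^ k) ^ 3 * E ^ k := by
          rw [mul_pow, mul_pow, ← pow_mul, ← pow_mul, mul_comm 3 k]
        have e2 : (Real.exp 4 * 96) ^ k = (Real.exp 4 * 48) ^ k * 2 ^ k := by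
          rw [← mul_pow]; congr 1; ring
        have hrk : r ^ k ≠ 0 := by positivity
        rw [hT, e1, e2, mul_pow]
        field_simp

end Final

section Main

set_option linter.unusedSectionVars false

open scoped Classical

variable {K : Type*} [Field K] [Fintype K]

/-- If `w ≤ c log log n`, then `w q ^ w` is of smaller order than `n`. -/
theorem exists_forall_mul_pow_le {c κ : ℝ} (hκ : 0 < κ) (q : ℕ) (hq : 2 ≤ q) :
    ∃ N₀ : ℕ, ∀ n : ℕ, N₀ ≤ n → ∀ w : ℕ, (w : ℝ) ≤ c * Real.log (Real.log n) →
      ((w * q ^ w : ℕ) : ℝ) ≤ κ * n := by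
  set A := c * Real.log (2 * q) with hA
  have h1 := (isLittleO_log_rpow_rpow_atTop A (zero_lt_one)).bound hκ
  have h2 := (tendsto_natCast_atTop_atTop (R := ℝ)).eventually h1
  obtain ⟨N, hN⟩ := Filter.eventually_atTop.1 h2
  refine ⟨max N 3, fun n hn w hw => ?_⟩
  have hn3 : (3 : ℝ) ≤ n := by exact_mod_cast (le_max_right N 3).trans hn
  have hlog : 0 < Real.log n := Real.log_pos (by linarith)
  have hb := hN n ((le_max_left N 3).trans hn)
  rw [Real.rpow_one, Real.norm_of_nonneg (by positivity), Real.norm_of_nonneg (by positivity)] at hb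
  refine le_trans ?_ hb
  have hq2 : (2 : ℝ) ≤ q := by exact_mod_cast hq
  have hq0 : (0 : ℝ) < 2 * q := by linarith
  have hlq : 0 ≤ Real.log (2 * q) := Real.log_nonneg (by linarith)
  calc ((w * q ^ w : ℕ) : ℝ) ≤ ((2 ^ w * q ^ w : ℕ) : ℝ) := by
        exact_mod_cast Nat.mul_le_mul_right _ Nat.lt_two_pow_self.le
    _ = (2 * q : ℝ) ^ (w : ℝ) := by push_cast; rw [Real.rpow_natCast, mul_pow]
    _ = Real.exp (Real.log (2 * q) * w) := by rw [Real.rpow_def_of_pos hq0]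
    _ ≤ Real.exp (Real.log (2 * q) * (c * Real.log (Real.log n))) := by gcongr
    _ = Real.log n ^ A := by
        rw [Real.rpow_def_of_pos hlog, hA]; congr 1; ring

/-- The size conditions hold for all large `w` and all `n` with `w ≤ c log log n`. -/
theorem exists_sieveRange {k : ℕ} (h : Fin k → K[X]) (h_inj : Function.Injective h) {η κ c : ℝ}
    (hη : 0 < η) (hκ : 0 < κ) (hc : 0 < c) :
    ∃ w₀ : ℕ, ∀ w : ℕ, w₀ ≤ w → ∀ n : ℕ, (w : ℝ) ≤ c * Real.log (Real.log n) →
      SieveRange h (η * n) w n ∧ (setDeg natDegree (primesBelow K w) : ℝ) ≤ κ * n := by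
  have hq : 2 ≤ Fintype.card K := Fintype.one_lt_card
  obtain ⟨N₁, hN₁⟩ := exists_forall_mul_pow_le (c := c) (lt_min hη (lt_min hκ one_pos))
    (Fintype.card K) hq
  set H := ∑ j, (h j).natDegree with hH
  have hHj : ∀ j, (h j).natDegree ≤ H := fun j =>
    Finset.single_le_sum (f := fun j => (h j).natDegree) (fun _ _ => Nat.zero_le _)
      (Finset.mem_univ j)
  set N := max N₁ (max ⌈1 / η⌉₊ (H + 1)) with hN
  refine ⟨max ⌈c * N⌉₊ (max 4 (H + 1)), fun w hw n hwn => ?_⟩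
  have hw1 : ⌈c * (N : ℝ)⌉₊ ≤ w := (le_max_left _ _).trans hw
  have hw4 : 4 ≤ w := ((le_max_left _ _).trans (le_max_right _ _)).trans hw
  have hwH : H + 1 ≤ w := ((le_max_right _ _).trans (le_max_right _ _)).trans hw
  have hNn : N ≤ n := by
    have h1 : c * (N : ℝ) ≤ w := (Nat.le_ceil _).trans (by exact_mod_cast hw1)
    have h2 : Real.log (Real.log n) ≤ n :=
      (Real.log_le_self (Real.log_natCast_nonneg n)).trans (Real.log_le_self (Nat.cast_nonneg n))
    have h3 : c * (N : ℝ) ≤ c * n := h1.trans (hwn.trans (by gcongr))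
    exact_mod_cast le_of_mul_le_mul_left h3 hc
  have hn1 : N₁ ≤ n := (le_max_left _ _).trans hNn
  have hn2 : ⌈1 / η⌉₊ ≤ n := ((le_max_left _ _).trans (le_max_right _ _)).trans hNn
  have hn3 : H + 1 ≤ n := ((le_max_right _ _).trans (le_max_right _ _)).trans hNn
  have hwq := hN₁ n hn1 w hwn
  have hn0 : (0 : ℝ) ≤ n := Nat.cast_nonneg n
  have hdeg : (setDeg natDegree (primesBelow K w) : ℝ) ≤
      min η (min κ 1) * n := le_trans (by exact_mod_cast setDeg_primesBelow_le w) hwq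
  have hwn' : w ≤ n := by
    have h1 : w ≤ w * Fintype.card K ^ w :=
      Nat.le_mul_of_pos_right _ (pow_pos Fintype.card_pos _)
    have h2 : (w : ℝ) ≤ n := by
      calc (w : ℝ) ≤ ((w * Fintype.card K ^ w : ℕ) : ℝ) := by exact_mod_cast h1
        _ ≤ min η (min κ 1) * n := hwq
        _ ≤ 1 * n := by gcongr; exact (min_le_right _ _).trans (min_le_right _ _)
        _ = n := one_mul _
    exact_mod_cast h2
  have hge : ∀ p ∈ primesBelow K (n + 1) \ primesBelow K w, IsPrimePoly p ∧ w ≤ p.natDegree := by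
    intro p hp
    obtain ⟨h1, h2⟩ := Finset.mem_sdiff.1 hp
    have hpp := (mem_primesBelow.1 h1).1
    exact ⟨hpp, not_lt.1 fun hlt => h2 (mem_primesBelow.2 ⟨hpp, hlt⟩)⟩
  refine ⟨⟨?_, by omega, ?_, fun p hp => ?_, fun j => ?_, fun i j hij p hp hd => ?_⟩, ?_⟩
  · have h1 : 1 / η ≤ n := (Nat.le_ceil _).trans (by exact_mod_cast hn2)
    rw [div_le_iff₀ hη] at h1
    linarith
  · exact hdeg.trans (by gcongr; exact min_le_left _ _)
  · have h2 := two_le_card (K := K)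
    unfold polyNorm
    calc (16 : ℝ) = 2 ^ 4 := by norm_num
      _ ≤ (Fintype.card K : ℝ) ^ 4 := by gcongr
      _ ≤ _ := pow_le_pow_right₀ (by linarith) (hw4.trans (hge p hp).2)
  · have := hHj j; omega
  · have hne : h i - h j ≠ 0 := sub_ne_zero.2 fun he => hij (h_inj he)
    have h1 := natDegree_le_of_dvd hd hne
    have h2 := natDegree_sub_le (h i) (h j)
    have h3 := (hge p hp).2
    have := hHj i
    have := hHj j
    have : max (h i).natDegree (h j).natDegree ≤ H := max_le ‹_› ‹_›
    omega
  · exact hdeg.trans (by gcongr; exact (min_le_right _ _).trans (min_le_left _ _))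

/-- A polynomial outside `P_ε(H)` in an admissible residue class modulo `W` has a translate with
a prime factor of degree at least `w` and less than `ε n`. -/
theorem SieveRange.exists_prime_dvd {k : ℕ} (hk : 1 ≤ k) {h : Fin k → K[X]} {r ε : ℝ} {w n : ℕ}
    (H : SieveRange h r w n) {b : K[X]} (hb : ∀ j, IsCoprime (primorial K w) (b + h j)) {f : K[X]}
    (hf : f ∈ monicFinset K n) (hfb : primorial K w ∣ f - b)
    (hfε : f ∉ almostPrimeTranslates h ε n) :
    ∃ p ∈ (primesBelow K (n + 1) \ primesBelow K w).filter
      (fun p => (p.natDegree : ℝ) < ε * n), ∃ i, p ∣ f + h i := by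
  set g := ∏ j, (f + h j) with hg
  have hlt : (leastPrimeDegree g : ℝ) < ε * n := not_le.1 hfε
  have hne : g ≠ 0 := Finset.prod_ne_zero_iff.2 fun j _ => (H.ne_zero hf j).1
  have hn : 0 < n := (Nat.zero_le _).trans_lt (H.deg_h ⟨0, hk⟩)
  have hgdeg : 0 < g.natDegree := by
    have h1 : (f + h ⟨0, hk⟩) ∣ g := Finset.dvd_prod_of_mem _ (Finset.mem_univ _)
    have := natDegree_le_of_dvd h1 hne
    rw [(H.ne_zero hf _).2] at this
    omega
  have hnonempty : {m | ∃ p : K[X], IsPrimePoly p ∧ p ∣ g ∧ p.natDegree = m}.Nonempty := by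
    obtain ⟨p, hp, hpg, -⟩ := PolySieve.exists_prime_dvd hgdeg
    exact ⟨_, p, hp, hpg, rfl⟩
  obtain ⟨p, hp, hpg, hpd⟩ := Nat.sInf_mem hnonempty
  obtain ⟨i, -, hi⟩ := hp.2.prime.exists_mem_finset_dvd hpg
  refine ⟨p, Finset.mem_filter.2 ⟨Finset.mem_sdiff.2 ⟨mem_primesBelow.2 ⟨hp, ?_⟩, fun hpw => ?_⟩,
    ?_⟩, i, hi⟩
  · have := natDegree_le_of_dvd hi (H.ne_zero hf i).1
    rw [(H.ne_zero hf i).2] at this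
    omega
  · have hpW : p ∣ primorial K w := by rw [primorial_eq]; exact dvd_setProd_of_mem hpw
    have h1 : p ∣ b + h i := by
      have := dvd_sub hi (hpW.trans hfb)
      rwa [show f + h i - (f - b) = b + h i by ring] at this
    exact hp.2.not_isUnit ((hb i).isUnit_of_dvd' hpW h1)
  · rw [hpd]; exact hlt

end Main

end PolySieve

end

theorem mainTheorem5 {K : Type*} [Field K] [Fintype K] {k : ℕ} (hk : 1 ≤ k)
    (F : (Fin k → ℝ) → ℝ) (hF : PolySieve.IsSieveFunction F)
    (η : ℝ) (hη₀ : 0 < η) (hη₁ : η < 1 / 2)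
    (h : Fin k → K[X]) (h_inj : Function.Injective h)
    (h_adm : PolySieve.Admissible (Set.range h)) :
    ∃ C : ℝ, 0 < C ∧ ∀ c : ℝ, 0 < c → ∃ w₀ : ℕ, ∀ w : ℕ, w₀ ≤ w → ∀ n : ℕ,
      (w : ℝ) ≤ c * Real.log (Real.log n) →
      ∀ b : K[X], (∀ j, IsCoprime (PolySieve.primorial K w) (b + h j)) →
      ∀ ε : ℝ, 0 < ε → ε < η →
        PolySieve.exceptionalSum F h (η * n) ε w n b ≤
          C * ε * (PolySieve.polyNorm (PolySieve.primorial K w) ^ (k - 1) /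
              (PolySieve.totient (PolySieve.primorial K w) : ℝ) ^ k *
            ((Fintype.card K : ℝ) ^ n / (η * n) ^ k)) := by
  classical
  open PolySieve in
  obtain ⟨C, hC0, hC⟩ := hF.exists_sq_sieveSum_le (K := K)
  set C₁ := C * (Real.exp 4 * 96) ^ k * Real.exp (2 ^ k * k * 256) with hC₁
  have hC₁0 : 0 < C₁ := by positivity
  set δ := (1 - 2 * η) / 2 with hδ
  have hδ0 : 0 < δ := by rw [hδ]; linarith
  refine ⟨C₁ * k / η + C₁ / δ, by positivity, fun c hc => ?_⟩
  obtain ⟨w₀, hw₀⟩ := exists_sieveRange h h_inj hη₀ hδ0 hc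
  refine ⟨w₀, fun w hw n hwn b hb ε hε₀ hε₁ => ?_⟩
  obtain ⟨H, hdegW⟩ := hw₀ w hw n hwn
  have hr := H.one_le
  have hr0 : 0 < η * (n : ℝ) := by linarith
  have hn0 : (0 : ℝ) < n := pos_of_mul_pos_right hr0 hη₀.le
  have hq := card_pos_real (K := K)
  have hVp : ∀ p ∈ primesBelow K w, IsPrimePoly p := isPrimePoly_of_mem subset_rfl
  have hE : 1 ≤ eulerFactor polyNorm (primesBelow K w) :=
    one_le_eulerFactor fun p hp => two_le_polyNorm (hVp p hp)
  have hWpos : 0 < polyNorm (primorial K w) := by unfold polyNorm; positivity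
  set T := (Fintype.card K : ℝ) ^ n / polyNorm (primorial K w) *
        eulerFactor polyNorm (primesBelow K w) ^ k / (η * n) ^ k with hT
  have hT0 : 0 ≤ T := by positivity
  have hTeq : polyNorm (primorial K w) ^ (k - 1) / (totient (primorial K w) : ℝ) ^ k *
      ((Fintype.card K : ℝ) ^ n / (η * n) ^ k) = T := by
    have hpow : polyNorm (primorial K w) ^ k =
        polyNorm (primorial K w) ^ (k - 1) * polyNorm (primorial K w) := by
      rw [← pow_succ, Nat.sub_add_cancel hk]
    rw [hT, eulerFactor_primesBelow, div_pow, hpow]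
    field_simp
  rw [hTeq]
  set Y : K[X] → ℝ := fun f => (∑ᶠ d ∈ sieveTuples h w f, sieveWeight F (η * n) d) ^ 2 with hY
  have hY0 : ∀ f, 0 ≤ Y f := fun f => sq_nonneg _
  have hfin : {f : K[X] | f ∈ monicOfDegree K n \ almostPrimeTranslates h ε n ∧
      primorial K w ∣ f - b}.Finite :=
    (finite_monicOfDegree K n).subset fun f hf => hf.1.1
  have hexc : exceptionalSum F h (η * n) ε w n b = ∑ f ∈ hfin.toFinset, Y f :=
    finsum_mem_eq_finite_toFinset_sum _ hfin
  have hmem : ∀ f ∈ hfin.toFinset, f ∈ monicFinset K n ∧ primorial K w ∣ f - b ∧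
      f ∉ almostPrimeTranslates h ε n := by
    intro f hf
    rw [Set.Finite.mem_toFinset] at hf
    exact ⟨mem_monicFinset.2 hf.1.1, hf.2, hf.1.2⟩
  rw [hexc]
  rcases le_or_gt δ ε with hδε | hεδ
  · have hdeg : (setDeg natDegree (primesBelow K w) : ℝ) + 2 * (η * n) ≤ n := by
      have : δ * (n : ℝ) + 2 * (η * n) ≤ n := by rw [hδ]; nlinarith
      linarith
    have h1 := H.sum_sq_le hC0 hC (Finset.filter_subset (fun f => primorial K w ∣ f - b) _)
      (zero_le_one) fun y hy => by rw [one_mul]; exact H.sum_prod_le hdeg b hy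
    rw [← hC₁, mul_one] at h1
    calc ∑ f ∈ hfin.toFinset, Y f
        ≤ ∑ f ∈ (monicFinset K n).filter (fun f => primorial K w ∣ f - b), Y f :=
          Finset.sum_le_sum_of_subset_of_nonneg
            (fun f hf => Finset.mem_filter.2 ⟨(hmem f hf).1, (hmem f hf).2.1⟩) fun f _ _ => hY0 f
      _ ≤ C₁ * T := h1
      _ ≤ (C₁ * k / η + C₁ / δ) * ε * T := by
          refine mul_le_mul_of_nonneg_right ?_ hT0
          have h2 : C₁ ≤ C₁ / δ * ε := by
            rw [div_mul_eq_mul_div, le_div_iff₀ hδ0]; gcongr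
          have h3 : 0 ≤ C₁ * k / η * ε := by positivity
          linarith
  · set R := (primesBelow K (n + 1) \ primesBelow K w).filter
      (fun p => (p.natDegree : ℝ) < ε * n) with hR
    have hmain : ∀ p ∈ R, ∀ i : Fin k,
        ∑ f ∈ (monicFinset K n).filter (fun f => primorial K w ∣ f - b ∧ p ∣ f + h i), Y f ≤
        C₁ * (((p.natDegree : ℝ) / (η * n)) ^ 2 / polyNorm p) * T := by
      intro p hp i
      obtain ⟨hp, hpε⟩ := Finset.mem_filter.1 hp
      have hdeg : (setDeg natDegree (primesBelow K w) : ℝ) + p.natDegree + 2 * (η * n) ≤ n := by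
        have h1 : δ * (n : ℝ) + δ * n + 2 * (η * n) ≤ n := by rw [hδ]; nlinarith
        have h2 : ε * (n : ℝ) ≤ δ * n := by gcongr
        linarith
      exact H.sum_sq_le hC0 hC (Finset.filter_subset _ _)
        (by unfold polyNorm; positivity) fun y hy => H.sum_prod_le_of_dvd hp hdeg b i hy
    calc ∑ f ∈ hfin.toFinset, Y f
        ≤ ∑ f ∈ hfin.toFinset, ∑ p ∈ R, ∑ i, if p ∣ f + h i then Y f else 0 := by
          refine Finset.sum_le_sum fun f hf => ?_
          obtain ⟨hf1, hf2, hf3⟩ := hmem f hf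
          obtain ⟨p, hp, i, hi⟩ := H.exists_prime_dvd hk hb hf1 hf2 hf3
          have hnn : ∀ p i, 0 ≤ if p ∣ f + h i then Y f else 0 := fun p i => by
            split_ifs
            · exact hY0 f
            · exact le_rfl
          calc Y f = if p ∣ f + h i then Y f else 0 := (if_pos hi).symm
            _ ≤ ∑ i, if p ∣ f + h i then Y f else 0 :=
              Finset.single_le_sum (f := fun i => if p ∣ f + h i then Y f else 0)
                (fun i _ => hnn p i) (Finset.mem_univ i)
            _ ≤ _ := Finset.single_le_sum (f := fun p => ∑ i, if p ∣ f + h i then Y f else 0)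
                (fun p _ => Finset.sum_nonneg fun i _ => hnn p i) hp
      _ = ∑ p ∈ R, ∑ i, ∑ f ∈ hfin.toFinset.filter (fun f => p ∣ f + h i), Y f := by
          rw [Finset.sum_comm]
          refine Finset.sum_congr rfl fun p _ => ?_
          rw [Finset.sum_comm]
          exact Finset.sum_congr rfl fun i _ => (Finset.sum_filter _ _).symm
      _ ≤ ∑ p ∈ R, ∑ _i : Fin k, C₁ * (((p.natDegree : ℝ) / (η * n)) ^ 2 / polyNorm p) * T := by
          refine Finset.sum_le_sum fun p hp => Finset.sum_le_sum fun i _ => ?_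
          refine le_trans (Finset.sum_le_sum_of_subset_of_nonneg (fun f hf => ?_)
            fun f _ _ => hY0 f) (hmain p hp i)
          obtain ⟨hf1, hf2⟩ := Finset.mem_filter.1 hf
          exact Finset.mem_filter.2 ⟨(hmem f hf1).1, (hmem f hf1).2.1, hf2⟩
      _ = C₁ * k * T / (η * n) ^ 2 * ∑ p ∈ R, (p.natDegree : ℝ) ^ 2 / polyNorm p := by
          rw [Finset.mul_sum]
          refine Finset.sum_congr rfl fun p _ => ?_
          rw [Finset.sum_const, Finset.card_univ, Fintype.card_fin, nsmul_eq_mul, div_pow]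
          ring
      _ ≤ C₁ * k * T / (η * n) ^ 2 * (ε * n) ^ 2 := by
          gcongr
          refine le_trans (Finset.sum_le_sum_of_subset_of_nonneg
            (Finset.filter_subset_filter _ Finset.sdiff_subset) fun p _ _ => ?_)
            (sum_sq_natDegree_div_le (n + 1) (by positivity))
          unfold polyNorm; positivity
      _ = C₁ * k / η * (ε / η) * ε * T := by field_simp
      _ ≤ C₁ * k / η * 1 * ε * T := by
          gcongr
          rw [div_le_one hη₀]; exact hε₁.le
      _ ≤ (C₁ * k / η + C₁ / δ) * ε * T := by
          rw [mul_one]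
          gcongr
          have : 0 ≤ C₁ / δ := by positivity
          linarith
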